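/- Let $q$ be an odd prime and let $\mathbb{F}_q^\infty=\prod_{j\ge 0}\mathbb{F}_q$ with the product topology, with $|x|=q^{-j}$ where $j$ is the index of the first nonzero component of $x=(x_0,x_1,\dots)\neq 0$, and $|0|=0$. Its dual group consists of the finitely supported sequences $\xi=(\xi_1,\xi_2,\dots)$ over $\mathbb{F}_q$, with $|\xi|=q^{j}$ where $j$ is the largest index of a nonzero component of $\xi\ne 0$, and $|0|=0$. For a finite Borel measure $\mu$ on $\mathbb{F}_q^\infty$ put $\hat\mu(\xi)=\int \exp\bigl(\tfrac{2\pi i}{q}\sum_{k\ge1}\xi_k x_{k-1}\bigr)\,d\mu(x)$. For a compact set $E\subset\mathbb{F}_q^\infty$, a Borel probability measure $\mu$ with $\mu(E^c)=0$, and real numbers $\alpha,\beta$, consider the conditions (1)$_\alpha$ there are a constant $C_1>0$ and a Borel set $E'\subset E$ with $\mu(E')>0$ such that $\mu(B\cap E')\le C_1 r^{\alpha}$ for every closed ball $B\subset\mathbb{F}_q^\infty$ of radius $r>0$; (2)$_\beta$ there is a constant $C_2>0$ such that $|\hat\mu(\xi)|\le C_2|\xi|^{-\beta/2}$ for all $\xi\neq0$.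 Then: (a) For every $\beta$ with $2/3<\beta<1$ there is $\alpha\in(0,1)$, depending only on $q$ and $\beta$, such that whenever $E$ and $\mu$ as above satisfy (1)$_\alpha$ and (2)$_\beta$, the set $E$ contains a nontrivial three-term arithmetic progression, that is, $x,\,x+a,\,x+2a\in E$ for some $x$ and some $a\neq0$. (b) If $2/3<\beta<1$ and $E,\mu$ as above satisfy (2)$_\beta$, then they satisfy (1)$_\alpha$ for every $0\le\alpha<\beta$. (c) There is $\beta_0<1$, depending only on $q$, such that for every $\beta$ with $\beta_0<\beta<1$, whenever $E$ and $\mu$ as above satisfy (2)$_\beta$, the set $E$ contains a nontrivial three-term arithmetic progression. -/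

import Mathlib

open MeasureTheory

noncomputable section

/-- The compact group of sequences `(x_0, x_1, x_2, …)` over `ZMod q`, with coordinatewise
addition, the product topology (each factor `ZMod q` being discrete) and the product
σ-algebra, which is the Borel σ-algebra. -/
abbrev FqInf (q : ℕ) : Type := ℕ → ZMod q

/-- The dual group: finitely supported sequences. The entry `ξ k` (indexed from `0`) is the
component usually written `ξ_{k+1}`. -/
abbrev FqInfDual (q : ℕ) : Type := ℕ →₀ ZMod q

namespace FqInf

open Classical in
/-- `|x| = q ^ (-j)`, where `j` is the first index with `x j ≠ 0`, and `|0| = 0`. -/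
def absVal {q : ℕ} (x : FqInf q) : ℝ :=
  if x = 0 then 0 else (q : ℝ) ^ (-(sInf {j : ℕ | x j ≠ 0} : ℕ) : ℤ)

open Classical in
/-- `|ξ| = q ^ j`, where `j` is the largest index (counted from `1`) of a nonzero component
of `ξ`, and `|0| = 0`. -/
def dualAbsVal {q : ℕ} (ξ : FqInfDual q) : ℝ :=
  if ξ = 0 then 0 else (q : ℝ) ^ (ξ.support.sup id + 1)

/-- The pairing `ξ · x = ∑ ξ_{k+1} x_k`, a finite sum in `ZMod q`. -/
def pairing {q : ℕ} (ξ : FqInfDual q) (x : FqInf q) : ZMod q :=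
  ξ.sum fun k c => c * x k

/-- The closed ball of radius `r` about `x`. -/
def ball {q : ℕ} (x : FqInf q) (r : ℝ) : Set (FqInf q) := {y | absVal (y - x) ≤ r}

/-- The Fourier transform `∫ exp (2 π i (ξ · x) / q) dμ(x)` of a measure; the additive character
`ZMod.stdAddChar` sends `j` to `exp (2 π i j / q)`. -/
def fourierTransform {q : ℕ} [NeZero q] (μ : Measure (FqInf q)) (ξ : FqInfDual q) : ℂ :=
  ∫ x, (ZMod.stdAddChar (pairing ξ x) : ℂ) ∂μ

/-- The `α`-dimensional ball condition with constant `C`. -/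
def BallCondition {q : ℕ} (ν : Measure (FqInf q)) (C α : ℝ) : Prop :=
  ∀ (x : FqInf q) (r : ℝ), 0 < r → ν (ball x r) ≤ ENNReal.ofReal (C * r ^ α)

/-- The restriction of `μ` to some (Borel) part `E'` of `E` of positive measure satisfies the
`α`-dimensional ball condition, with some positive constant. -/
def PartialBallCondition {q : ℕ} (E : Set (FqInf q)) (μ : Measure (FqInf q)) (α : ℝ) : Prop :=
  ∃ C₁ : ℝ, 0 < C₁ ∧ ∃ E' : Set (FqInf q), MeasurableSet E' ∧ E' ⊆ E ∧ 0 < μ E' ∧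
    BallCondition (μ.restrict E') C₁ α

/-- `|μ̂(ξ)| ≤ C₂ |ξ| ^ (-β/2)` for some positive constant `C₂` and all `ξ ≠ 0`
(at `ξ = 0` the right-hand side is `+∞`, so there is no condition). -/
def FourierDecay {q : ℕ} [NeZero q] (μ : Measure (FqInf q)) (β : ℝ) : Prop :=
  ∃ C₂ : ℝ, 0 < C₂ ∧ ∀ ξ : FqInfDual q, ξ ≠ 0 →
    ‖fourierTransform μ ξ‖ ≤ C₂ * dualAbsVal ξ ^ (-β / 2)

/-- `E` is compact and carries the probability measure `μ`. -/
structure CompactCarrier {q : ℕ} (E : Set (FqInf q)) (μ : Measure (FqInf q)) : Prop where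
  isCompact : IsCompact E
  isProbabilityMeasure : IsProbabilityMeasure μ
  measure_compl : μ Eᶜ = 0

/-- `E` contains `x, x + a, x + 2a` for some `x` and some `a ≠ 0`. -/
def HasThreeTermAP {q : ℕ} (E : Set (FqInf q)) : Prop :=
  ∃ x a : FqInf q, a ≠ 0 ∧ x ∈ E ∧ x + a ∈ E ∧ x + 2 • a ∈ E

end FqInf

end

/-! Two bounds for the number of approximate progressions at one scale `n` contradict each other.
Let Λ(n, N) be q^N times the μ³-mass of the triples (x, y, z) for which x - 2y + z vanishes below
level `N` while x - y does not vanish below level `n`. By orthogonality of characters, Λ(n, N) is a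
sum of products of three Fourier coefficients over frequencies supported below `N`
(`sum_tripleCoeff`).

Upper bound (`exists_approxAPs_le`): if E has no nontrivial progression, compactness gives Λ(n, N) =
0 for some `N`, so Λ(n, n) is minus the tail over the shells from `n` to `N`. A shell of size about
q^j contributes at most a constant times q^(j(1 - 3β/2)), and β > 2/3 makes this summable. Hence
Λ(n, n) is at most a constant times q^(-κn), with κ = 3β/2 - 1.

Lower bound: the ball condition forces at least a constant times q^(αn) heavy cells at level `n`.
The slice rank argument gives a power-saving bound for progression-free sets, and averaging it over
affine maps from a space of dimension d ≈ γn (`supersaturation`) gives many progressions of heavy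
cells. For α close to 1 this makes Λ(n, n) larger than q^(-κn) allows once `n` is large. The
constants of the measure affect only `n`, so α depends on q and β alone.

Fourier decay implies the ball condition through an energy estimate and a Chebyshev argument
(`partialBallCondition_of_fourierDecay`). Fixing one exponent such as 3/4 in the first result and
taking β above the resulting α then removes the ball hypothesis. -/

/-! ### Slice rank of the diagonal tensor -/

section SliceRank

variable {K ι : Type*} [Field K] [Fintype ι]

-- An element of `W` whose support is smaller than the dimension can be improved: some nonzero
-- element of `W` vanishes on that support, and adding it enlarges the support.
open Classical in
theorem Submodule.exists_mem_finrank_le_card_support (W : Submodule K (ι → K)) :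
    ∃ h ∈ W, Module.finrank K W ≤ (Finset.univ.filter fun i => h i ≠ 0).card := by
  suffices H : ∀ k ≤ Module.finrank K W, ∃ h ∈ W,
      k ≤ (Finset.univ.filter fun i => h i ≠ 0).card from H _ le_rfl
  intro k
  induction k with
  | zero => exact fun _ => ⟨0, W.zero_mem, Nat.zero_le _⟩
  | succ k ih =>
    intro hk
    obtain ⟨h, hW, hcard⟩ := ih (Nat.le_of_succ_le hk)
    by_cases hlt : k + 1 ≤ (Finset.univ.filter fun i => h i ≠ 0).card
    · exact ⟨h, hW, hlt⟩
    set s := Finset.univ.filter fun i => h i ≠ 0 with hs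
    let φ : W →ₗ[K] (s → K) := (LinearMap.funLeft K K (Subtype.val : s → ι)).comp W.subtype
    have hker : LinearMap.ker φ ≠ ⊥ := by
      apply LinearMap.ker_ne_bot_of_finrank_lt
      rw [Module.finrank_fintype_fun_eq_card, Fintype.card_coe]
      omega
    obtain ⟨w, hw, hw0⟩ := (Submodule.ne_bot_iff _).1 hker
    have hws : ∀ i ∈ s, (w : ι → K) i = 0 := fun i hi => congrFun (LinearMap.mem_ker.1 hw) ⟨i, hi⟩
    obtain ⟨j, hj⟩ : ∃ j, (w : ι → K) j ≠ 0 := by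
      by_contra! hall
      exact hw0 (Subtype.ext (funext hall))
    have hjs : j ∉ s := fun hjs => hj (hws j hjs)
    refine ⟨h + w, W.add_mem hW w.2, ?_⟩
    have hsub : insert j s ⊆ Finset.univ.filter fun i => (h + (w : ι → K)) i ≠ 0 := by
      intro i hi
      rw [Finset.mem_insert] at hi
      simp only [Finset.mem_filter, Finset.mem_univ, true_and, Pi.add_apply]
      rcases hi with rfl | hi
      · have : h i = 0 := by simpa [hs] using hjs
        simpa [this] using hj
      · rw [hws i hi, add_zero]
        simpa [hs] using hi
    calc k + 1 ≤ (insert j s).card := by rw [Finset.card_insert_of_notMem hjs]; omega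
      _ ≤ _ := Finset.card_le_card hsub

open Classical in
/-- Tao's lemma: the slice rank of the diagonal tensor of side `ι` is at least `card ι`. -/
theorem card_le_of_diagonal_eq_sum_slices {I₁ I₂ I₃ : Type*} [Fintype I₁] [Fintype I₂] [Fintype I₃]
    (f₁ : I₁ → ι → K) (g₁ : I₁ → ι → ι → K) (f₂ : I₂ → ι → K) (g₂ : I₂ → ι → ι → K)
    (f₃ : I₃ → ι → K) (g₃ : I₃ → ι → ι → K)
    (hdiag : ∀ x y z, (if x = y ∧ y = z then (1 : K) else 0) =
      ∑ i, f₁ i x * g₁ i y z + ∑ i, f₂ i y * g₂ i x z + ∑ i, f₃ i z * g₃ i x y) :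
    Fintype.card ι ≤ Fintype.card I₁ + Fintype.card I₂ + Fintype.card I₃ := by
  -- Contract the tensor in `z` with a vector `h` orthogonal to every `f₃ i`. The third family
  -- disappears, and the diagonal matrix of `h` factors through `I₁ ⊕ I₂`. Its rank is the support
  -- size of `h`, which can be taken at least `card ι - card I₃`.
  let φ : (ι → K) →ₗ[K] (I₃ → K) := Matrix.mulVecLin (Matrix.of f₃)
  have hφ : Fintype.card ι ≤ Module.finrank K (LinearMap.ker φ) + Fintype.card I₃ := by
    have h1 := LinearMap.finrank_range_add_finrank_ker φ
    have h2 := Submodule.finrank_le (LinearMap.range φ)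
    rw [Module.finrank_fintype_fun_eq_card] at h1 h2
    omega
  obtain ⟨h, hker, hcard⟩ := Submodule.exists_mem_finrank_le_card_support (LinearMap.ker φ)
  have horth : ∀ i, ∑ z, f₃ i z * h z = 0 := fun i => congrFun (LinearMap.mem_ker.1 hker) i
  let P : Matrix ι (I₁ ⊕ I₂) K :=
    Matrix.of fun x => Sum.elim (fun i => f₁ i x) fun i => ∑ z, h z * g₂ i x z
  let Q : Matrix (I₁ ⊕ I₂) ι K :=
    Matrix.of (Sum.elim (fun i y => ∑ z, h z * g₁ i y z) fun i y => f₂ i y)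
  have hPQ : Matrix.diagonal h = P * Q := by
    ext x y
    have hz : ∀ z, h z * (if x = y ∧ y = z then (1 : K) else 0) =
        ∑ i, f₁ i x * (h z * g₁ i y z) + ∑ i, (h z * g₂ i x z) * f₂ i y
          + ∑ i, (f₃ i z * h z) * g₃ i x y := by
      intro z
      rw [hdiag, mul_add, mul_add, Finset.mul_sum, Finset.mul_sum, Finset.mul_sum]
      congr 1
      · congr 1 <;> exact Finset.sum_congr rfl fun i _ => by ring
      · exact Finset.sum_congr rfl fun i _ => by ring
    have hsum : ∑ z, h z * (if x = y ∧ y = z then (1 : K) else 0) = Matrix.diagonal h x y := by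
      rw [Matrix.diagonal_apply]
      by_cases hxy : x = y <;> simp [hxy]
    have h3 : ∑ z, ∑ i, (f₃ i z * h z) * g₃ i x y = 0 := by
      rw [Finset.sum_comm]
      exact Finset.sum_eq_zero fun i _ => by rw [← Finset.sum_mul, horth, zero_mul]
    rw [← hsum, Finset.sum_congr rfl fun z _ => hz z, Finset.sum_add_distrib,
      Finset.sum_add_distrib, h3, add_zero, Matrix.mul_apply, Fintype.sum_sum_type]
    congr 1
    · rw [Finset.sum_comm]
      exact Finset.sum_congr rfl fun i _ => by simp [P, Q, Finset.mul_sum]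
    · rw [Finset.sum_comm]
      exact Finset.sum_congr rfl fun i _ => by simp [P, Q, Finset.sum_mul]
  have hrank : (Finset.univ.filter fun i => h i ≠ 0).card ≤
      Fintype.card I₁ + Fintype.card I₂ := by
    rw [← Fintype.card_subtype, ← Matrix.rank_diagonal, hPQ, ← Fintype.card_sum]
    exact (Matrix.rank_mul_le_left P Q).trans (Matrix.rank_le_card_width P)
  omega

end SliceRank

/-! ### The Ellenberg–Gijswijt bound -/

section CapSet

/-- With k = q - 1 this is the factor of the indicator of x - 2y + z = 0 at one coordinate. Only the
degree bound on the monomials matters later; the coefficients are trinomial. -/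
theorem exists_one_sub_pow_expansion {R : Type*} [CommRing R] (k : ℕ) :
    ∃ (T : Finset (ℕ × ℕ × ℕ)) (c : ℕ × ℕ × ℕ → R), (∀ t ∈ T, t.1 + t.2.1 + t.2.2 ≤ k) ∧
      ∀ x y z : R, 1 - (x - 2 * y + z) ^ k =
        ∑ t ∈ T, c t * (x ^ t.1 * y ^ t.2.1 * z ^ t.2.2) := by
  classical
  let T : Finset (ℕ × ℕ × ℕ) :=
    (Finset.range (k + 1) ×ˢ (Finset.range (k + 1) ×ˢ Finset.range (k + 1))).filter
      fun t => t.1 + t.2.1 + t.2.2 ≤ k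
  let d : ℕ → ℕ → R := fun i j => (k.choose i : R) * ((k - i).choose j : R) * (-2) ^ j
  refine ⟨T, fun t => (if t = (0, 0, 0) then 1 else 0) -
    if t.1 + t.2.1 + t.2.2 = k then d t.1 t.2.1 else 0, fun t ht => (Finset.mem_filter.1 ht).2,
    fun x y z => ?_⟩
  simp only [sub_mul, Finset.sum_sub_distrib]
  congr 1
  · rw [Finset.sum_eq_single (0, 0, 0)]
    · simp
    · intro t _ ht
      simp [ht]
    · intro h
      exact absurd h (by simp [T])
  · have hx : x - 2 * y + z = x + (-2 * y + z) := by ring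
    rw [hx, add_pow]
    have hinner : ∀ i, x ^ i * (-2 * y + z) ^ (k - i) * (k.choose i : R) =
        ∑ j ∈ Finset.range (k - i + 1), d i j * (x ^ i * y ^ j * z ^ (k - i - j)) := by
      intro i
      rw [add_pow, Finset.mul_sum, Finset.sum_mul]
      exact Finset.sum_congr rfl fun j _ => by simp only [d, mul_pow]; ring
    rw [Finset.sum_congr rfl fun i _ => hinner i, Finset.sum_sigma']
    simp only [ite_mul, zero_mul]
    rw [← Finset.sum_filter]
    refine Finset.sum_bij' (fun p _ => (p.1, p.2, k - p.1 - p.2)) (fun t _ => ⟨t.1, t.2.1⟩)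
      ?_ ?_ ?_ ?_ ?_
    · rintro ⟨i, j⟩ h
      simp only [Finset.mem_sigma, Finset.mem_range] at h
      simp only [T, Finset.mem_filter, Finset.mem_product, Finset.mem_range]
      omega
    · rintro ⟨i, j, l⟩ h
      simp only [T, Finset.mem_filter, Finset.mem_product, Finset.mem_range] at h
      simp only [Finset.mem_sigma, Finset.mem_range]
      omega
    · rintro ⟨i, j⟩ _
      rfl
    · rintro ⟨i, j, l⟩ h
      simp only [T, Finset.mem_filter, Finset.mem_product, Finset.mem_range] at h
      simp only [Prod.mk.injEq, true_and]
      omega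
    · rintro ⟨i, j⟩ _
      rfl

variable {q : ℕ} [Fact q.Prime]

/-- The exponent vectors of the monomials in `d` variables with individual degrees less than `q`
and total degree at most `(q - 1) d / 3`. -/
def lowDegreeExponents (q d : ℕ) : Finset (Fin d → ℕ) :=
  (Fintype.piFinset fun _ => Finset.range q).filter fun a => 3 * ∑ i, a i ≤ (q - 1) * d

theorem indicator_eq_prod {d : ℕ} (w : Fin d → ZMod q) :
    (if w = 0 then (1 : ZMod q) else 0) = ∏ i, (1 - w i ^ (q - 1)) := by
  have hq1 : q - 1 ≠ 0 := by have := (Fact.out : q.Prime).two_le; omega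
  by_cases h : w = 0
  · simp [h, hq1]
  · rw [if_neg h]
    obtain ⟨i, hi⟩ := Function.ne_iff.1 h
    refine (Finset.prod_eq_zero (Finset.mem_univ i) ?_).symm
    rw [ZMod.pow_card_sub_one_eq_one hi, sub_self]

/-- The bound of Croot–Lev–Pach and Ellenberg–Gijswijt in terms of counts of monomials. -/
theorem ThreeAPFree.card_le_lowDegreeExponents {d : ℕ} (hq : Odd q) {A : Finset (Fin d → ZMod q)}
    (hA : ThreeAPFree (A : Set (Fin d → ZMod q))) :
    A.card ≤ 3 * (lowDegreeExponents q d).card := by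
  classical
  have hq2 : 2 ≤ q := (Fact.out : q.Prime).two_le
  obtain ⟨T, c, hT, hexp⟩ := exists_one_sub_pow_expansion (R := ZMod q) (q - 1)
  let mon : (Fin d → ℕ) → (Fin d → ZMod q) → ZMod q := fun a x => ∏ i, x i ^ a i
  let U : Finset (Fin d → ℕ × ℕ × ℕ) := Fintype.piFinset fun _ => T
  let ea : (Fin d → ℕ × ℕ × ℕ) → Fin d → ℕ := fun t i => (t i).1
  let eb : (Fin d → ℕ × ℕ × ℕ) → Fin d → ℕ := fun t i => (t i).2.1
  let ec : (Fin d → ℕ × ℕ × ℕ) → Fin d → ℕ := fun t i => (t i).2.2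
  let C : (Fin d → ℕ × ℕ × ℕ) → ZMod q := fun t => ∏ i, c (t i)
  let low := lowDegreeExponents q d
  -- The degrees in x, y and z add up to at most (q - 1)d, so one of them is at most a third of
  -- that. Each monomial is assigned to the first variable of low degree, which gives three families
  -- of slices.
  let U₁ := U.filter fun t => ea t ∈ low
  let U₂ := (U.filter fun t => ¬ ea t ∈ low).filter fun t => eb t ∈ low
  let U₃ := (U.filter fun t => ¬ ea t ∈ low).filter fun t => ¬ eb t ∈ low
  have hU₃ : ∀ t ∈ U₃, ec t ∈ low := by
    intro t ht
    simp only [U₃, U, low, lowDegreeExponents, Finset.mem_filter, Fintype.mem_piFinset,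
      Finset.mem_range, ea, eb, ec] at ht ⊢
    obtain ⟨⟨htU, ha⟩, hb⟩ := ht
    have hbd := fun i => hT _ (htU i)
    have hsum : ∑ i, ((t i).1 + (t i).2.1 + (t i).2.2) ≤ (q - 1) * d := by
      calc _ ≤ ∑ _i : Fin d, (q - 1) := Finset.sum_le_sum fun i _ => hbd i
        _ = _ := by simp [mul_comm]
    rw [Finset.sum_add_distrib, Finset.sum_add_distrib] at hsum
    have h1 : ∀ i, (t i).1 < q ∧ (t i).2.1 < q ∧ (t i).2.2 < q := fun i => by
      have := hbd i; omega
    have ha' : ¬ 3 * ∑ i, (t i).1 ≤ (q - 1) * d := fun h => ha ⟨fun i => (h1 i).1, h⟩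
    have hb' : ¬ 3 * ∑ i, (t i).2.1 ≤ (q - 1) * d := fun h => hb ⟨fun i => (h1 i).2.1, h⟩
    refine ⟨fun i => (h1 i).2.2, ?_⟩
    omega
  have hmain : ∀ x y z : Fin d → ZMod q, (if x - 2 • y + z = 0 then (1 : ZMod q) else 0) =
      ∑ a ∈ low, mon a x * (∑ t ∈ U₁ with ea t = a, C t * (mon (eb t) y * mon (ec t) z)) +
      ∑ b ∈ low, mon b y * (∑ t ∈ U₂ with eb t = b, C t * (mon (ea t) x * mon (ec t) z)) +
      ∑ e ∈ low, mon e z * (∑ t ∈ U₃ with ec t = e, C t * (mon (ea t) x * mon (eb t) y)) := by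
    intro x y z
    have h0 : (if x - 2 • y + z = 0 then (1 : ZMod q) else 0) =
        ∑ t ∈ U, C t * (mon (ea t) x * mon (eb t) y * mon (ec t) z) := by
      rw [indicator_eq_prod]
      have : ∀ i, 1 - (x - 2 • y + z) i ^ (q - 1) =
          ∑ t ∈ T, c t * (x i ^ t.1 * y i ^ t.2.1 * z i ^ t.2.2) := by
        intro i
        rw [← hexp]
        simp
      rw [Finset.prod_congr rfl fun i _ => this i, Finset.prod_univ_sum]
      refine Finset.sum_congr rfl fun t _ => ?_
      simp only [Finset.prod_mul_distrib, C, mon, ea, eb, ec]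
    rw [h0, ← Finset.sum_filter_add_sum_filter_not U (fun t => ea t ∈ low),
      ← Finset.sum_filter_add_sum_filter_not (U.filter fun t => ¬ ea t ∈ low)
        (fun t => eb t ∈ low), ← add_assoc]
    congr 1
    · congr 1
      · rw [← Finset.sum_fiberwise_of_maps_to (s := U₁) (t := low) (g := ea)
          fun t ht => (Finset.mem_filter.1 ht).2]
        refine Finset.sum_congr rfl fun a _ => ?_
        rw [Finset.mul_sum]
        refine Finset.sum_congr rfl fun t ht => ?_
        rw [(Finset.mem_filter.1 ht).2]
        ring
      · rw [← Finset.sum_fiberwise_of_maps_to (s := U₂) (t := low) (g := eb)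
          fun t ht => (Finset.mem_filter.1 ht).2]
        refine Finset.sum_congr rfl fun a _ => ?_
        rw [Finset.mul_sum]
        refine Finset.sum_congr rfl fun t ht => ?_
        rw [(Finset.mem_filter.1 ht).2]
        ring
    · rw [← Finset.sum_fiberwise_of_maps_to (s := U₃) (t := low) (g := ec) hU₃]
      refine Finset.sum_congr rfl fun a _ => ?_
      rw [Finset.mul_sum]
      refine Finset.sum_congr rfl fun t ht => ?_
      rw [(Finset.mem_filter.1 ht).2]
      ring
  -- On a progression-free set the indicator of x - 2y + z = 0 is the diagonal tensor.
  have hfin := card_le_of_diagonal_eq_sum_slices (K := ZMod q) (ι := A)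
    (I₁ := low) (I₂ := low) (I₃ := low)
    (fun a x => mon a x)
    (fun a y z => ∑ t ∈ U₁ with ea t = a, C t * (mon (eb t) y * mon (ec t) z))
    (fun a y => mon a y)
    (fun a x z => ∑ t ∈ U₂ with eb t = a, C t * (mon (ea t) x * mon (ec t) z))
    (fun a z => mon a z)
    (fun a x y => ∑ t ∈ U₃ with ec t = a, C t * (mon (ea t) x * mon (eb t) y)) (by
      intro x y z
      rw [Finset.sum_coe_sort low fun a => mon a x * ∑ t ∈ U₁ with ea t = a,
          C t * (mon (eb t) y * mon (ec t) z),
        Finset.sum_coe_sort low fun a => mon a y * ∑ t ∈ U₂ with eb t = a,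
          C t * (mon (ea t) x * mon (ec t) z),
        Finset.sum_coe_sort low fun a => mon a z * ∑ t ∈ U₃ with ec t = a,
          C t * (mon (ea t) x * mon (eb t) y), ← hmain]
      have h2 : (2 : ZMod q) ≠ 0 := by
        intro h
        have := (ZMod.natCast_eq_zero_iff 2 q).1 (by exact_mod_cast h)
        have := Nat.le_of_dvd two_pos this
        obtain rfl : q = 2 := by omega
        exact absurd hq (by decide)
      have hiff : (x = y ∧ y = z) ↔ (x : Fin d → ZMod q) - 2 • (y : Fin d → ZMod q) + z = 0 := by
        constructor
        · rintro ⟨rfl, rfl⟩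
          rw [two_nsmul]; abel
        · intro h
          have hxz : (x : Fin d → ZMod q) + z = y + y := by
            rw [← sub_eq_zero, ← h, two_nsmul]; abel
          have hxy : (x : Fin d → ZMod q) = y := hA x.2 y.2 z.2 hxz
          refine ⟨Subtype.ext hxy, Subtype.ext ?_⟩
          rw [hxy] at hxz
          exact (add_left_cancel hxz).symm
      simp only [hiff])
  simp only [Fintype.card_coe, low] at hfin
  omega

/-- The two sides agree at s = 1, where the left side has derivative 3n(n-1)/2 and the right side
n(n-1). Just to the left of 1 the left side is therefore smaller. This strict inequality is the
source of the power saving. -/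
theorem exists_sum_pow_lt (n : ℕ) (hn : 2 ≤ n) :
    ∃ s : ℝ, 0 < s ∧ s < 1 ∧ ∑ i ∈ Finset.range n, s ^ (3 * i) < n * s ^ (n - 1) := by
  let g : ℝ → ℝ := fun s => ∑ i ∈ Finset.range n, s ^ (3 * i) - n * s ^ (n - 1)
  have hderiv : HasDerivAt g ((n : ℝ) * (n - 1) / 2) 1 := by
    have h1 : HasDerivAt g (∑ i ∈ Finset.range n, ((3 * i : ℕ) : ℝ) * 1 ^ (3 * i - 1) -
        n * (((n - 1 : ℕ) : ℝ) * 1 ^ (n - 1 - 1))) 1 :=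
      (HasDerivAt.fun_sum fun i _ => hasDerivAt_pow (3 * i) (1 : ℝ)).sub
        ((hasDerivAt_pow (n - 1) (1 : ℝ)).const_mul _)
    convert h1 using 1
    have hsum : (∑ i ∈ Finset.range n, (i : ℝ)) = n * (n - 1) / 2 := by
      have := Finset.sum_range_id_mul_two n
      have h2 : (∑ i ∈ Finset.range n, (i : ℝ)) * 2 = n * ((n - 1 : ℕ) : ℝ) := by
        rw [← Nat.cast_sum]
        exact_mod_cast this
      rw [Nat.cast_sub (by omega)] at h2
      push_cast at h2
      linarith
    simp only [one_pow, mul_one, Nat.cast_mul, ← Finset.mul_sum, hsum]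
    rw [Nat.cast_sub (by omega)]
    push_cast
    ring
  have hpos : (0 : ℝ) < (n : ℝ) * (n - 1) / 2 := by
    have : (2 : ℝ) ≤ n := by exact_mod_cast hn
    have : (0 : ℝ) < (n : ℝ) * (n - 1) := mul_pos (by linarith) (by linarith)
    linarith
  have hev : ∀ᶠ s in nhdsWithin (1 : ℝ) {1}ᶜ, 0 < slope g 1 s :=
    (hasDerivAt_iff_tendsto_slope.1 hderiv).eventually (lt_mem_nhds hpos)
  have hev2 : ∀ᶠ s in nhdsWithin (1 : ℝ) (Set.Iio 1), 0 < slope g 1 s :=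
    hev.filter_mono (nhdsWithin_mono _ fun s hs => ne_of_lt hs)
  have hev3 : ∀ᶠ s in nhdsWithin (1 : ℝ) (Set.Iio 1), s ∈ Set.Ioo (0 : ℝ) 1 :=
    Ioo_mem_nhdsLT one_pos
  obtain ⟨s, hs, hs0, hs1⟩ := (hev2.and hev3).exists
  refine ⟨s, hs0, hs1, ?_⟩
  have hg1 : g 1 = 0 := by simp [g]
  rw [slope_def_field, hg1, sub_zero] at hs
  have : g s < 0 := by
    by_contra! h
    exact absurd hs (not_lt.2 (div_nonpos_of_nonneg_of_nonpos h (by linarith)))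
  simpa [g] using this

/-- Chernoff's method: weight an exponent vector by s to three times its degree. Low-degree vectors
have weight at least s^((q-1)d), and the total weight factors over the coordinates. -/
theorem card_lowDegreeExponents_le {s : ℝ} (hs0 : 0 < s) (hs1 : s < 1) (q d : ℕ) :
    ((lowDegreeExponents q d).card : ℝ) ≤
      ((∑ i ∈ Finset.range q, s ^ (3 * i)) / s ^ (q - 1)) ^ d := by
  have hprod : (∑ i ∈ Finset.range q, s ^ (3 * i)) ^ d =
      ∑ a ∈ Fintype.piFinset fun _ : Fin d => Finset.range q, ∏ i, s ^ (3 * a i) := by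
    rw [← Fin.prod_const d, Finset.prod_univ_sum]
  rw [div_pow, le_div_iff₀ (by positivity), ← pow_mul, ← nsmul_eq_mul, ← Finset.sum_const, hprod]
  calc ∑ _a ∈ lowDegreeExponents q d, s ^ ((q - 1) * d)
      ≤ ∑ a ∈ lowDegreeExponents q d, ∏ i, s ^ (3 * a i) := by
        refine Finset.sum_le_sum fun a ha => ?_
        rw [Finset.prod_pow_eq_pow_sum, ← Finset.mul_sum]
        exact pow_le_pow_of_le_one hs0.le hs1.le (Finset.mem_filter.1 ha).2
    _ ≤ _ := Finset.sum_le_sum_of_subset_of_nonneg (Finset.filter_subset _ _)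
        fun a _ _ => by positivity

/-- Ellenberg–Gijswijt: sets without three-term progressions in `𝔽_q ^ d` have power-saving
size. -/
theorem exists_threeAPFree_card_le (hq : Odd q) : ∃ ρ : ℝ, 0 < ρ ∧ ρ < q ∧
    ∀ (d : ℕ) (A : Finset (Fin d → ZMod q)), ThreeAPFree (A : Set (Fin d → ZMod q)) →
      (A.card : ℝ) ≤ 3 * ρ ^ d := by
  have hq2 : 2 ≤ q := (Fact.out : q.Prime).two_le
  obtain ⟨s, hs0, hs1, hs⟩ := exists_sum_pow_lt q hq2
  refine ⟨(∑ i ∈ Finset.range q, s ^ (3 * i)) / s ^ (q - 1), ?_, ?_, fun d A hA => ?_⟩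
  · have : 0 < ∑ i ∈ Finset.range q, s ^ (3 * i) :=
      Finset.sum_pos (fun i _ => by positivity) ⟨0, by simp; omega⟩
    positivity
  · rwa [div_lt_iff₀ (by positivity)]
  · have h1 : (A.card : ℝ) ≤ 3 * ((lowDegreeExponents q d).card : ℝ) := by
      exact_mod_cast hA.card_le_lowDegreeExponents hq
    have h2 := card_lowDegreeExponents_le hs0 hs1 q d
    linarith

end CapSet

/-! ### Supersaturation of progressions -/

section Supersaturation

open Classical in
/-- The pairs `(x, a)` for which `x, x + a, x + 2a` all lie in `A`. -/
noncomputable def apPairs {V : Type*} [AddCommGroup V] [Fintype V] (A : Finset V) : Finset (V × V) :=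
  Finset.univ.filter fun p => p.1 ∈ A ∧ p.1 + p.2 ∈ A ∧ p.1 + 2 • p.2 ∈ A

theorem mem_apPairs {V : Type*} [AddCommGroup V] [Fintype V] {A : Finset V} {p : V × V} :
    p ∈ apPairs A ↔ p.1 ∈ A ∧ p.1 + p.2 ∈ A ∧ p.1 + 2 • p.2 ∈ A := by
  simp [apPairs]

-- Deleting the first term of every nontrivial progression leaves a progression-free set.
open Classical in
theorem card_sub_le_card_apPairs_ne_zero {W : Type*} [AddCommGroup W] [Fintype W] {M : ℝ}
    (hM : ∀ A : Finset W, ThreeAPFree (A : Set W) → (A.card : ℝ) ≤ M) (A : Finset W) :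
    (A.card : ℝ) - M ≤ ((apPairs A).filter fun p => p.2 ≠ 0).card := by
  set P := (apPairs A).filter fun p => p.2 ≠ 0 with hP
  have hfree : ThreeAPFree ((A \ P.image Prod.fst : Finset W) : Set W) := by
    intro a ha b hb c hc habc
    by_contra hab
    simp only [Finset.coe_sdiff, Set.mem_sdiff, Finset.mem_coe] at ha hb hc
    refine ha.2 (Finset.mem_image.2 ⟨(a, b - a), ?_, rfl⟩)
    simp only [hP, apPairs, Finset.mem_filter, Finset.mem_univ, true_and]
    refine ⟨⟨ha.1, by simpa using hb.1, ?_⟩, sub_ne_zero.2 (Ne.symm hab)⟩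
    have : a + 2 • (b - a) = c := by
      rw [smul_sub, two_nsmul, two_nsmul, ← habc]; abel
    rw [this]; exact hc.1
  have h1 := hM _ hfree
  have h2 : A.card ≤ (A \ P.image Prod.fst).card + P.card := by
    have := Finset.le_card_sdiff (P.image Prod.fst) A
    have := Finset.card_image_le (s := P) (f := Prod.fst)
    omega
  have h3 : (A.card : ℝ) ≤ (A \ P.image Prod.fst).card + P.card := by exact_mod_cast h2
  linarith

variable {K V : Type*} [Field K] [AddCommGroup V] [Module K V] [Fintype V] {d : ℕ}

/-- A nontrivial linear combination of independent uniform vectors is uniform: shifting one `e k`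
with `u k ≠ 0` realises every translation of the value. -/
theorem sum_linearCombination_eq {u : Fin d → K} (hu : u ≠ 0) (G : V → ℝ) :
    (Fintype.card V : ℝ) * ∑ e : Fin d → V, G (∑ i, u i • e i) =
      (Fintype.card V : ℝ) ^ d * ∑ w, G w := by
  classical
  obtain ⟨k, hk⟩ := Function.ne_iff.1 hu
  have hshift : ∀ w, ∑ e : Fin d → V, G (∑ i, u i • e i) =
      ∑ e : Fin d → V, G (∑ i, u i • e i + w) := by
    intro w
    rw [← Equiv.sum_comp (Equiv.addRight (Pi.single k ((u k)⁻¹ • w) : Fin d → V))]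
    refine Finset.sum_congr rfl fun e _ => congrArg G ?_
    simp only [Equiv.coe_addRight, Pi.add_apply, smul_add, Finset.sum_add_distrib]
    congr 1
    rw [Finset.sum_eq_single k]
    · rw [Pi.single_eq_same, smul_inv_smul₀ hk]
    · intro i _ hi
      rw [Pi.single_eq_of_ne hi, smul_zero]
    · simp
  calc (Fintype.card V : ℝ) * ∑ e : Fin d → V, G (∑ i, u i • e i)
      = ∑ w, ∑ e : Fin d → V, G (∑ i, u i • e i + w) := by
        rw [← Finset.sum_congr rfl fun w _ => hshift w]; simp
    _ = ∑ e : Fin d → V, ∑ w, G w := by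
        rw [Finset.sum_comm]
        exact Finset.sum_congr rfl fun e _ =>
          Equiv.sum_comp (Equiv.addLeft (∑ i, u i • e i)) G
    _ = _ := by simp

/-- Progressions in `A` abound: average the deletion bound over the affine maps `K ^ d → V`. -/
theorem supersaturation [Fintype K] {M : ℝ}
    (hM : ∀ A : Finset (Fin d → K), ThreeAPFree (A : Set (Fin d → K)) → (A.card : ℝ) ≤ M)
    (A : Finset V) :
    (Fintype.card V : ℝ) * A.card * (Fintype.card K : ℝ) ^ d - M * (Fintype.card V : ℝ) ^ 2 ≤
      ((Fintype.card K : ℝ) ^ d) ^ 2 * (apPairs A).card := by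
  classical
  set N : ℝ := (Fintype.card V : ℝ) with hN
  set Q : ℝ := (Fintype.card K : ℝ) ^ d with hQ
  have hNpos : 0 < N := by
    have : 0 < Fintype.card V := Fintype.card_pos
    exact Nat.cast_pos.2 this
  have hcardW : (Fintype.card (Fin d → K) : ℝ) = Q := by simp [hQ]
  -- The deletion bound is applied to the preimage `B v e` of `A` under each affine map. A direction
  -- `b ≠ 0` may be sent to zero, so trivial progressions of `A` are counted as well.
  let Φ : V → (Fin d → V) → (Fin d → K) → V := fun v e u => v + ∑ i, u i • e i
  let B : V → (Fin d → V) → Finset (Fin d → K) := fun v e => Finset.univ.filter fun u => Φ v e u ∈ A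
  let ind : V → V → ℝ := fun x a => if (x, a) ∈ apPairs A then 1 else 0
  have hpoint : ∀ v e, ((B v e).card : ℝ) - M ≤
      ∑ u, ∑ b : Fin d → K, if b ≠ 0 then ind (Φ v e u) (∑ i, b i • e i) else 0 := by
    intro v e
    refine (card_sub_le_card_apPairs_ne_zero hM (B v e)).trans (le_of_eq ?_)
    rw [← Finset.sum_product', Finset.univ_product_univ, Finset.card_filter, Nat.cast_sum,
      apPairs, Finset.sum_filter]
    refine Finset.sum_congr rfl fun p _ => ?_
    have h1 : Φ v e (p.1 + p.2) = Φ v e p.1 + ∑ i, p.2 i • e i := by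
      simp only [Φ, Pi.add_apply, add_smul, Finset.sum_add_distrib, add_assoc]
    have h2 : Φ v e (p.1 + 2 • p.2) = Φ v e p.1 + 2 • ∑ i, p.2 i • e i := by
      simp only [Φ, Pi.add_apply, add_smul, Finset.sum_add_distrib, add_assoc,
        two_nsmul]
    simp only [B, ind, apPairs, Finset.mem_filter, Finset.mem_univ, true_and, h1, h2]
    split_ifs <;> simp_all
  have hfirst : ∑ v, ∑ e, ((B v e).card : ℝ) = Q * N ^ d * A.card := by
    have : ∀ v e, ((B v e).card : ℝ) = ∑ u, if Φ v e u ∈ A then (1 : ℝ) else 0 := by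
      intro v e; simp [B]
    simp only [this]
    rw [Finset.sum_comm]
    have h2 : ∀ e, ∑ v, ∑ u, (if Φ v e u ∈ A then (1 : ℝ) else 0) = Q * A.card := by
      intro e
      rw [Finset.sum_comm]
      have h3 : ∀ u, ∑ v, (if Φ v e u ∈ A then (1 : ℝ) else 0) = A.card := by
        intro u
        refine (Equiv.sum_comp (Equiv.addRight (∑ i, u i • e i))
          (fun v => if v ∈ A then (1 : ℝ) else 0)).trans ?_
        simp
      simp only [h3, Finset.sum_const, Finset.card_univ, nsmul_eq_mul, hcardW]
    simp only [h2, Finset.sum_const, Finset.card_univ, nsmul_eq_mul]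
    simp [hN]; ring
  -- For fixed `u` and `b ≠ 0`, the image progression is uniform among all pairs: `e` makes its
  -- difference uniform, and `v` makes its first term uniform given `e`.
  have hsecond : ∀ u b : Fin d → K, N * ∑ v, ∑ e,
      (if b ≠ 0 then ind (Φ v e u) (∑ i, b i • e i) else 0) ≤ N ^ d * (apPairs A).card := by
    intro u b
    by_cases hb : b = 0
    · simp only [hb, ne_eq, not_true_eq_false, if_false, Finset.sum_const_zero, mul_zero]
      positivity
    · simp only [ne_eq, hb, not_false_eq_true, if_true]
      rw [Finset.sum_comm]
      have h3 : ∀ e, ∑ v, ind (Φ v e u) (∑ i, b i • e i) = ∑ v, ind v (∑ i, b i • e i) := fun e =>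
        Equiv.sum_comp (Equiv.addRight (∑ i, u i • e i)) fun v => ind v (∑ i, b i • e i)
      simp only [h3]
      rw [sum_linearCombination_eq hb fun w => ∑ v, ind v w, Finset.sum_comm,
        ← Finset.sum_product', Finset.univ_product_univ]
      simp [ind, hN]
  have htotal : Q * N ^ d * A.card - M * (N * N ^ d) ≤ ∑ v, ∑ e, ∑ u, ∑ b : Fin d → K,
      if b ≠ 0 then ind (Φ v e u) (∑ i, b i • e i) else 0 := by
    rw [← hfirst]
    calc _ = ∑ v, ∑ e, (((B v e).card : ℝ) - M) := by
          simp only [Finset.sum_sub_distrib, Finset.sum_const, Finset.card_univ, nsmul_eq_mul]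
          simp [hN]; ring
      _ ≤ _ := Finset.sum_le_sum fun v _ => Finset.sum_le_sum fun e _ => hpoint v e
  have hswap : ∑ v, ∑ e, ∑ u, ∑ b : Fin d → K,
      (if b ≠ 0 then ind (Φ v e u) (∑ i, b i • e i) else 0) =
      ∑ u, ∑ b : Fin d → K, ∑ v, ∑ e,
        (if b ≠ 0 then ind (Φ v e u) (∑ i, b i • e i) else 0) := by
    simp only [← Finset.sum_product', Finset.univ_product_univ]
    exact Fintype.sum_equiv ⟨fun x => (x.2.2.1, x.2.2.2, x.1, x.2.1),
      fun x => (x.2.2.1, x.2.2.2, x.1, x.2.1), fun _ => rfl, fun _ => rfl⟩ _ _ fun _ => rfl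
  rw [hswap] at htotal
  have h4 : N * (Q * N ^ d * A.card - M * (N * N ^ d)) ≤
      Q ^ 2 * (N ^ d * (apPairs A).card) := by
    calc _ ≤ N * _ := mul_le_mul_of_nonneg_left htotal hNpos.le
      _ ≤ ∑ u : Fin d → K, ∑ b : Fin d → K, N ^ d * ((apPairs A).card : ℝ) := by
        rw [Finset.mul_sum]
        refine Finset.sum_le_sum fun u _ => ?_
        rw [Finset.mul_sum]
        exact Finset.sum_le_sum fun b _ => hsecond u b
      _ = _ := by
        simp only [Finset.sum_const, Finset.card_univ, nsmul_eq_mul, hcardW]; ring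
  have h5 : 0 < N ^ d := by positivity
  refine le_of_mul_le_mul_left ?_ h5
  linarith

end Supersaturation

namespace FqInf

/-! ### Characters of `FqInf q` -/

section Characters

variable {q : ℕ}

theorem pairing_add_left (ξ η : FqInfDual q) (x : FqInf q) :
    pairing (ξ + η) x = pairing ξ x + pairing η x :=
  Finsupp.sum_add_index' (fun _ => zero_mul _) fun _ _ _ => add_mul _ _ _

theorem pairing_add_right (ξ : FqInfDual q) (x y : FqInf q) :
    pairing ξ (x + y) = pairing ξ x + pairing ξ y := by
  simp [pairing, mul_add, Finsupp.sum, Finset.sum_add_distrib]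

theorem pairing_neg_left (ξ : FqInfDual q) (x : FqInf q) : pairing (-ξ) x = -pairing ξ x :=
  (AddMonoidHom.mk' (fun ξ => pairing ξ x) fun ξ η => pairing_add_left ξ η x).map_neg ξ

theorem pairing_neg_right (ξ : FqInfDual q) (x : FqInf q) : pairing ξ (-x) = -pairing ξ x :=
  (AddMonoidHom.mk' (pairing ξ) (pairing_add_right ξ)).map_neg x

theorem pairing_single (k : ℕ) (c : ZMod q) (x : FqInf q) :
    pairing (Finsupp.single k c) x = c * x k :=
  Finsupp.sum_single_index (zero_mul _)

/-- The sequences whose first `n` components vanish. -/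
def vanishingBelow (q n : ℕ) : Set (FqInf q) := {x | ∀ i < n, x i = 0}

theorem isClopen_vanishingBelow (n : ℕ) : IsClopen (vanishingBelow q n) := by
  have : vanishingBelow q n = ⋂ i ∈ Finset.range n, (fun x : FqInf q => x i) ⁻¹' {0} := by
    ext x; simp [vanishingBelow]
  rw [this]
  exact isClopen_biInter_finset fun i _ => (isClopen_discrete _).preimage (continuous_apply i)

theorem measurableSet_vanishingBelow (n : ℕ) : MeasurableSet (vanishingBelow q n) := by
  have : vanishingBelow q n = ⋂ i ∈ Finset.range n, (fun x : FqInf q => x i) ⁻¹' {0} := by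
    ext x; simp [vanishingBelow]
  rw [this]
  exact Finset.measurableSet_biInter _ fun i _ => measurable_pi_apply i (measurableSet_singleton _)

theorem vanishingBelow_anti {m n : ℕ} (h : m ≤ n) : vanishingBelow q n ⊆ vanishingBelow q m :=
  fun _ hx i hi => hx i (hi.trans_le h)

theorem sub_mem_vanishingBelow_comm {n : ℕ} {x y : FqInf q} (h : x - y ∈ vanishingBelow q n) :
    y - x ∈ vanishingBelow q n := fun i hi => by
  have := h i hi
  simp only [Pi.sub_apply, sub_eq_zero] at this ⊢
  exact this.symm

variable [NeZero q]

theorem measurable_pairing (ξ : FqInfDual q) : Measurable (pairing ξ) :=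
  Finset.measurable_sum _ fun k _ =>
    (Measurable.of_discrete (f := fun c : ZMod q => ξ k * c)).comp (measurable_pi_apply k)

/-- The character of `FqInf q` given by a dual element. -/
noncomputable def char (ξ : FqInfDual q) (x : FqInf q) : ℂ := ZMod.stdAddChar (pairing ξ x)

theorem fourierTransform_eq (μ : Measure (FqInf q)) (ξ : FqInfDual q) :
    fourierTransform μ ξ = ∫ x, char ξ x ∂μ := rfl

theorem char_add_left (ξ η : FqInfDual q) (x : FqInf q) :
    char (ξ + η) x = char ξ x * char η x := by
  rw [char, pairing_add_left, AddChar.map_add_eq_mul]; rfl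

theorem char_add_right (ξ : FqInfDual q) (x y : FqInf q) :
    char ξ (x + y) = char ξ x * char ξ y := by
  rw [char, pairing_add_right, AddChar.map_add_eq_mul]; rfl

theorem char_neg_right (ξ : FqInfDual q) (x : FqInf q) : char ξ (-x) = char (-ξ) x := by
  rw [char, pairing_neg_right, ← pairing_neg_left]; rfl

theorem norm_char (ξ : FqInfDual q) (x : FqInf q) : ‖char ξ x‖ = 1 :=
  (ZMod.stdAddChar (N := q)).norm_apply _

theorem measurable_char (ξ : FqInfDual q) : Measurable (char ξ) :=
  (Measurable.of_discrete (f := fun c : ZMod q => ZMod.stdAddChar c)).comp (measurable_pairing ξ)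

theorem norm_fourierTransform_le (μ : Measure (FqInf q)) [IsProbabilityMeasure μ]
    (ξ : FqInfDual q) : ‖fourierTransform μ ξ‖ ≤ 1 := by
  rw [fourierTransform_eq]
  refine (norm_integral_le_of_norm_le_const (C := 1) (.of_forall fun x => (norm_char ξ x).le)).trans
    ?_
  simp

/-- The dual elements supported in `[0, n)`. -/
noncomputable def dualBelow (q n : ℕ) [NeZero q] : Finset (FqInfDual q) :=
  (Finset.range n).finsupp fun _ => Finset.univ

theorem mem_dualBelow {n : ℕ} {ξ : FqInfDual q} : ξ ∈ dualBelow q n ↔ ∀ i, n ≤ i → ξ i = 0 := by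
  simp only [dualBelow, Finset.mem_finsupp_iff, Finset.mem_univ, implies_true, and_true,
    Finset.subset_iff, Finsupp.mem_support_iff, Finset.mem_range]
  exact forall_congr' fun i => by rw [← not_le]; tauto

theorem card_dualBelow (n : ℕ) : (dualBelow q n).card = q ^ n := by
  simp [dualBelow, Finset.card_finsupp, ZMod.card]

theorem dualBelow_mono {m n : ℕ} (h : m ≤ n) : dualBelow q m ⊆ dualBelow q n := fun _ hξ =>
  mem_dualBelow.2 fun i hi => mem_dualBelow.1 hξ i (h.trans hi)

-- If `x k ≠ 0` for some `k < n`, multiplication by the character of `Finsupp.single k 1` permutes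
-- the summands and scales the sum by a number other than 1.
open Classical in
theorem sum_char_dualBelow (n : ℕ) (x : FqInf q) :
    ∑ ξ ∈ dualBelow q n, char ξ x = if x ∈ vanishingBelow q n then (q : ℂ) ^ n else 0 := by
  split_ifs with hx
  · have : ∀ ξ ∈ dualBelow q n, char ξ x = 1 := by
      intro ξ hξ
      have h0 : pairing ξ x = 0 := Finset.sum_eq_zero fun i hi => by
        have hin : i < n := by
          by_contra! h
          exact (Finsupp.mem_support_iff.1 hi) (mem_dualBelow.1 hξ i h)
        simp only [hx i hin, mul_zero]
      rw [char, h0, AddChar.map_zero_eq_one]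
    rw [Finset.sum_congr rfl this]
    simp [card_dualBelow]
  · obtain ⟨k, hk, hxk⟩ : ∃ k < n, x k ≠ 0 := by
      simpa [vanishingBelow] using hx
    set δ : FqInfDual q := Finsupp.single k 1 with hδ
    have hδx : char δ x ≠ 1 := by
      rw [char, hδ, pairing_single, one_mul, ← AddChar.map_zero_eq_one (ZMod.stdAddChar (N := q))]
      exact fun h => hxk (ZMod.injective_stdAddChar h)
    have hδn : ∀ i, n ≤ i → δ i = 0 := fun i hi => Finsupp.single_eq_of_ne (by omega)
    have hinv : char δ x * ∑ ξ ∈ dualBelow q n, char ξ x = ∑ ξ ∈ dualBelow q n, char ξ x := by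
      rw [Finset.mul_sum]
      refine Finset.sum_bij' (fun ξ _ => δ + ξ) (fun ξ _ => -δ + ξ) ?_ ?_ ?_ ?_ ?_
      · intro ξ hξ
        exact mem_dualBelow.2 fun i hi => by simp [hδn i hi, mem_dualBelow.1 hξ i hi]
      · intro ξ hξ
        exact mem_dualBelow.2 fun i hi => by simp [hδn i hi, mem_dualBelow.1 hξ i hi]
      · intro ξ _; simp
      · intro ξ _; simp
      · intro ξ _; rw [char_add_left]
    have : (char δ x - 1) * ∑ ξ ∈ dualBelow q n, char ξ x = 0 := by
      rw [sub_mul, hinv, one_mul, sub_self]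
    exact (mul_eq_zero.1 this).resolve_left (sub_ne_zero.2 hδx)

/-- The difference is split into shells by the last nonzero index `j`; such a shell has at most
q^(j+1) elements. -/
theorem norm_sum_dualBelow_sub_le {G : Type*} [SeminormedAddCommGroup G] {f : FqInfDual q → G}
    {b : ℕ → ℝ} {n N : ℕ} (hnN : n ≤ N)
    (hf : ∀ j, n ≤ j → ∀ ξ ∈ dualBelow q (j + 1), ξ j ≠ 0 → ‖f ξ‖ ≤ b j) :
    ‖∑ ξ ∈ dualBelow q N, f ξ - ∑ ξ ∈ dualBelow q n, f ξ‖ ≤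
      ∑ j ∈ Finset.Ico n N, (q : ℝ) ^ (j + 1) * |b j| := by
  classical
  induction N, hnN using Nat.le_induction with
  | base => simp
  | succ N hnN ih =>
    rw [Finset.sum_Ico_succ_top hnN]
    have hsplit : ∑ ξ ∈ dualBelow q (N + 1), f ξ - ∑ ξ ∈ dualBelow q n, f ξ =
        (∑ ξ ∈ dualBelow q N, f ξ - ∑ ξ ∈ dualBelow q n, f ξ) +
          ∑ ξ ∈ dualBelow q (N + 1) \ dualBelow q N, f ξ := by
      rw [← Finset.sum_sdiff (dualBelow_mono N.le_succ)]; abel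
    rw [hsplit]
    refine (norm_add_le _ _).trans (add_le_add ih ?_)
    refine (norm_sum_le _ _).trans ((Finset.sum_le_card_nsmul _ _ |b N| fun ξ hξ => ?_).trans ?_)
    · rw [Finset.mem_sdiff] at hξ
      refine (hf N hnN ξ hξ.1 fun h0 => hξ.2 (mem_dualBelow.2 fun i hi => ?_)).trans (le_abs_self _)
      rcases hi.eq_or_lt with rfl | hi
      · exact h0
      · exact mem_dualBelow.1 hξ.1 i hi
    · rw [nsmul_eq_mul]
      refine mul_le_mul_of_nonneg_right ?_ (abs_nonneg _)
      have := Finset.card_le_card (Finset.sdiff_subset (s := dualBelow q (N + 1))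
        (t := dualBelow q N))
      rw [card_dualBelow] at this
      exact_mod_cast this

theorem dualAbsVal_of_mem_dualBelow {j : ℕ} {ξ : FqInfDual q} (hξ : ξ ∈ dualBelow q (j + 1))
    (hj : ξ j ≠ 0) : dualAbsVal ξ = (q : ℝ) ^ (j + 1) := by
  have h0 : ξ ≠ 0 := by rintro rfl; exact hj rfl
  have hsup : ξ.support.sup id = j := by
    apply le_antisymm
    · refine Finset.sup_le fun i hi => ?_
      by_contra! h
      exact (Finsupp.mem_support_iff.1 hi) (mem_dualBelow.1 hξ i h)
    · exact Finset.le_sup (f := id) (Finsupp.mem_support_iff.2 hj)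
  rw [dualAbsVal, if_neg h0, hsup]

end Characters

/-! ### Absolute values and balls -/

section Balls

variable {q : ℕ}

theorem absVal_le_of_mem_vanishingBelow (hq : 1 ≤ q) {n : ℕ} {x : FqInf q}
    (hx : x ∈ vanishingBelow q n) : absVal x ≤ ((q : ℝ) ^ n)⁻¹ := by
  have hq' : (1 : ℝ) ≤ q := by exact_mod_cast hq
  rw [absVal]
  split_ifs with h0
  · positivity
  · have hne : {j : ℕ | x j ≠ 0}.Nonempty := Function.ne_iff.1 h0
    have hmem := Nat.sInf_mem hne
    have hle : n ≤ sInf {j : ℕ | x j ≠ 0} := by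
      by_contra! h
      exact hmem (hx _ h)
    rw [zpow_neg, zpow_natCast]
    exact inv_anti₀ (by positivity) (pow_le_pow_right₀ hq' hle)

/-- Nonzero absolute values are powers of q, so strict inequality gains one further coordinate. -/
theorem mem_vanishingBelow_of_absVal_lt (hq : 1 ≤ q) {n : ℕ} {x : FqInf q}
    (hx : absVal x < ((q : ℝ) ^ n)⁻¹) : x ∈ vanishingBelow q (n + 1) := by
  have hq' : (1 : ℝ) ≤ q := by exact_mod_cast hq
  intro i hi
  by_contra hxi
  have h0 : x ≠ 0 := by rintro rfl; exact hxi rfl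
  have hle : sInf {j : ℕ | x j ≠ 0} ≤ n := (Nat.sInf_le hxi).trans (by omega)
  rw [absVal, if_neg h0, zpow_neg, zpow_natCast] at hx
  exact absurd hx (not_lt.2 (inv_anti₀ (by positivity) (pow_le_pow_right₀ hq' hle)))

end Balls

end FqInf

namespace FqInf

/-! ### Energy estimate and the ball condition -/

section Energy

variable {q : ℕ} [Fact q.Prime]

theorem FourierDecay.exists_bound {μ : Measure (FqInf q)} {β : ℝ} (h : FourierDecay μ β) :
    ∃ C : ℝ, 0 < C ∧ ∀ j, ∀ ξ ∈ dualBelow q (j + 1), ξ j ≠ 0 →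
      ‖fourierTransform μ ξ‖ ≤ C * ((q : ℝ) ^ (j + 1)) ^ (-β / 2) := by
  obtain ⟨C, hC, hdec⟩ := h
  refine ⟨C, hC, fun j ξ hξ hj => ?_⟩
  rw [← dualAbsVal_of_mem_dualBelow hξ hj]
  exact hdec ξ (by rintro rfl; exact hj rfl)

theorem integrable_char (μ : Measure (FqInf q)) [IsFiniteMeasure μ] (ξ : FqInfDual q) :
    Integrable (char ξ) μ :=
  Integrable.of_bound (measurable_char ξ).aestronglyMeasurable 1
    (.of_forall fun x => (norm_char ξ x).le)

theorem measurableSet_prod_sub_mem (n : ℕ) :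
    MeasurableSet {p : FqInf q × FqInf q | p.1 - p.2 ∈ vanishingBelow q n} :=
  (measurable_fst.sub measurable_snd) (measurableSet_vanishingBelow n)

theorem prod_sub_mem_vanishingBelow_eq (μ : Measure (FqInf q)) [IsProbabilityMeasure μ] (n : ℕ) :
    ((q : ℂ) ^ n) * ((μ.prod μ).real {p | p.1 - p.2 ∈ vanishingBelow q n} : ℝ) =
      ∑ ξ ∈ dualBelow q n, fourierTransform μ ξ * fourierTransform μ (-ξ) := by
  classical
  have h1 : ∀ ξ, fourierTransform μ ξ * fourierTransform μ (-ξ) =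
      ∫ p : FqInf q × FqInf q, char ξ (p.1 - p.2) ∂(μ.prod μ) := by
    intro ξ
    rw [fourierTransform_eq, fourierTransform_eq, ← integral_prod_mul]
    simp only [sub_eq_add_neg, char_add_right, char_neg_right]
  rw [Finset.sum_congr rfl fun ξ _ => h1 ξ, ← integral_finsetSum]
  · have h2 : ∀ p : FqInf q × FqInf q, ∑ ξ ∈ dualBelow q n, char ξ (p.1 - p.2) =
        Set.indicator {p : FqInf q × FqInf q | p.1 - p.2 ∈ vanishingBelow q n}
          (fun _ => (q : ℂ) ^ n) p := by
      intro p
      rw [sum_char_dualBelow, Set.indicator_apply]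
      rfl
    simp only [h2]
    rw [integral_indicator_const _ (measurableSet_prod_sub_mem n), Complex.real_smul, mul_comm]
  · intro ξ _
    refine ((integrable_char μ ξ).mul_prod (integrable_char μ (-ξ))).congr (.of_forall fun p => ?_)
    simp only [sub_eq_add_neg, char_add_right, char_neg_right]

/-- By Parseval, q^n times the left side is a sum of |μ̂|² over frequencies below `n`. Shell `j`
contributes at most C² q^((j+1)(1-β)); since β < 1 these bounds grow geometrically and the last one
dominates. -/
theorem FourierDecay.exists_energy_le {μ : Measure (FqInf q)} [IsProbabilityMeasure μ] {β : ℝ}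
    (hβ : β < 1) (h : FourierDecay μ β) :
    ∃ K : ℝ, 0 < K ∧ ∀ n, (μ.prod μ).real {p | p.1 - p.2 ∈ vanishingBelow q n} ≤
      K * ((q : ℝ) ^ (-β)) ^ n := by
  obtain ⟨C, hC, hdec⟩ := h.exists_bound
  have hq1 : (1 : ℝ) < q := by exact_mod_cast (Fact.out : q.Prime).one_lt
  have hq0 : (0 : ℝ) < q := by linarith
  set τ : ℝ := (q : ℝ) ^ (1 - β) with hτ
  have hτ1 : 1 < τ := Real.one_lt_rpow hq1 (by linarith)
  -- The 1 accounts for the zero frequency, the other term for the geometric sum.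
  refine ⟨1 + C ^ 2 * (τ / (τ - 1)), ?_, fun n => ?_⟩
  · have : 0 < τ - 1 := by linarith
    positivity
  have hterm : ∀ j, 0 ≤ j → ∀ ξ ∈ dualBelow q (j + 1), ξ j ≠ 0 →
      ‖fourierTransform μ ξ * fourierTransform μ (-ξ)‖ ≤
        (C * ((q : ℝ) ^ (j + 1)) ^ (-β / 2)) ^ 2 := by
    intro j _ ξ hξ hj
    rw [norm_mul, sq]
    refine mul_le_mul (hdec j ξ hξ hj) (hdec j (-ξ) ?_ ?_) (norm_nonneg _) (by positivity)
    · exact mem_dualBelow.2 fun i hi => by simp [mem_dualBelow.1 hξ i hi]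
    · simpa using hj
  have hpow : ∀ j : ℕ, (q : ℝ) ^ (j + 1) * |(C * ((q : ℝ) ^ (j + 1)) ^ (-β / 2)) ^ 2| =
      C ^ 2 * τ * τ ^ j := by
    intro j
    have hx : (0 : ℝ) < (q : ℝ) ^ (j + 1) := by positivity
    have e1 : τ * τ ^ j = ((q : ℝ) ^ (j + 1)) ^ (1 - β) := by
      rw [hτ, ← pow_succ', Real.rpow_pow_comm hq0.le]
    have e2 : (((q : ℝ) ^ (j + 1)) ^ (-β / 2)) ^ 2 = ((q : ℝ) ^ (j + 1)) ^ (-β) := by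
      rw [← Real.rpow_mul_natCast hx.le]; congr 1; push_cast; ring
    rw [abs_of_nonneg (by positivity), mul_pow, e2, mul_assoc (C ^ 2), e1,
      show (1 - β) = 1 + -β by ring, Real.rpow_add hx, Real.rpow_one]
    ring
  have hsum := norm_sum_dualBelow_sub_le (n := 0) (N := n) (Nat.zero_le n) hterm
  rw [Finset.sum_congr rfl fun j _ => hpow j, ← Finset.mul_sum, ← Finset.range_eq_Ico,
    geom_sum_eq hτ1.ne'] at hsum
  have hS0 : ‖∑ ξ ∈ dualBelow q 0, fourierTransform μ ξ * fourierTransform μ (-ξ)‖ ≤ 1 := by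
    refine (norm_sum_le_of_le _ (f := fun ξ => fourierTransform μ ξ * fourierTransform μ (-ξ))
      (n := fun _ => 1) fun ξ _ => ?_).trans ?_
    · rw [norm_mul]
      exact mul_le_one₀ (norm_fourierTransform_le μ ξ) (norm_nonneg _)
        (norm_fourierTransform_le μ _)
    · simp [card_dualBelow]
  have hnorm := norm_le_norm_add_norm_sub'
    (∑ ξ ∈ dualBelow q n, fourierTransform μ ξ * fourierTransform μ (-ξ))
    (∑ ξ ∈ dualBelow q 0, fourierTransform μ ξ * fourierTransform μ (-ξ))
  have hle : (q : ℝ) ^ n * (μ.prod μ).real {p | p.1 - p.2 ∈ vanishingBelow q n} ≤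
      (1 + C ^ 2 * (τ / (τ - 1))) * τ ^ n := by
    have h3 : (q : ℝ) ^ n * (μ.prod μ).real {p | p.1 - p.2 ∈ vanishingBelow q n} =
        ‖∑ ξ ∈ dualBelow q n, fourierTransform μ ξ * fourierTransform μ (-ξ)‖ := by
      rw [← prod_sub_mem_vanishingBelow_eq, norm_mul, norm_pow, Complex.norm_natCast,
        Complex.norm_real, Real.norm_of_nonneg measureReal_nonneg]
    have hn1 : 1 ≤ τ ^ n := one_le_pow₀ hτ1.le
    have h4 : C ^ 2 * τ * ((τ ^ n - 1) / (τ - 1)) ≤ C ^ 2 * (τ / (τ - 1)) * τ ^ n := by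
      have : 0 < τ - 1 := by linarith
      have e : C ^ 2 * (τ / (τ - 1)) * τ ^ n - C ^ 2 * τ * ((τ ^ n - 1) / (τ - 1)) =
        C ^ 2 * τ / (τ - 1) := by field_simp; ring
      have : 0 ≤ C ^ 2 * τ / (τ - 1) := by positivity
      linarith
    rw [h3]
    linarith
  have hqn : (0 : ℝ) < (q : ℝ) ^ n := by positivity
  have e3 : τ ^ n = (q : ℝ) ^ n * ((q : ℝ) ^ (-β)) ^ n := by
    rw [← mul_pow, hτ, show (1 - β) = 1 + -β by ring, Real.rpow_add hq0, Real.rpow_one]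
  rw [e3] at hle
  refine le_of_mul_le_mul_left ?_ hqn
  linarith

theorem partialBallCondition_of_fourierDecay {E : Set (FqInf q)} {μ : Measure (FqInf q)}
    (hE : CompactCarrier E μ) {α β : ℝ} (hβ : β < 1) (h : FourierDecay μ β) (hα : 0 ≤ α)
    (hαβ : α < β) : PartialBallCondition E μ α := by
  have := hE.isProbabilityMeasure
  obtain ⟨K, hK, hen⟩ := h.exists_energy_le hβ
  have hq1 : (1 : ℝ) < q := by exact_mod_cast (Fact.out : q.Prime).one_lt
  have hq1' : 1 ≤ q := (Fact.out : q.Prime).one_lt.le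
  have hq0 : (0 : ℝ) < q := by linarith
  set σ : ℝ := (q : ℝ) ^ (-α) with hσ
  set ω : ℝ := (q : ℝ) ^ (α - β) with hω
  have hσ0 : 0 < σ := Real.rpow_pos_of_pos hq0 _
  have hω0 : 0 < ω := Real.rpow_pos_of_pos hq0 _
  have hω1 : ω < 1 := Real.rpow_lt_one_of_one_lt_of_neg hq1 (by linarith)
  have hωσ : (q : ℝ) ^ (-β) = ω * σ := by
    rw [hω, hσ, ← Real.rpow_add hq0]; congr 1; ring
  -- By Chebyshev the points whose level-`n` cell has mass at least M σ^n have measure at most (K/M)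
  -- ω^n. This `M` makes the bounds sum to 1/2, so at least half of the mass survives.
  set M : ℝ := 2 * K / (1 - ω) with hM
  have hM0 : 0 < M := div_pos (by linarith) (by linarith)
  let cell : ℕ → FqInf q → Set (FqInf q) := fun n x => {y | x - y ∈ vanishingBelow q n}
  let bad : ℕ → Set (FqInf q) := fun n => {x | ENNReal.ofReal (M * σ ^ n) ≤ μ (cell n x)}
  have hcellmeas : ∀ n, Measurable fun x => μ (cell n x) := fun n =>
    measurable_measure_prodMk_left (measurableSet_prod_sub_mem n)
  have hbadmeas : ∀ n, MeasurableSet (bad n) := fun n =>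
    measurableSet_le measurable_const (hcellmeas n)
  have hbad : ∀ n, μ (bad n) ≤ ENNReal.ofReal (K / M * ω ^ n) := by
    intro n
    have h1 : ENNReal.ofReal (M * σ ^ n) * μ (bad n) ≤
        (μ.prod μ) {p | p.1 - p.2 ∈ vanishingBelow q n} := by
      rw [Measure.prod_apply (measurableSet_prod_sub_mem n)]
      exact mul_meas_ge_le_lintegral (hcellmeas n) _
    have h2 : M * σ ^ n * μ.real (bad n) ≤ K * (ω * σ) ^ n := by
      rw [← hωσ]
      refine le_trans ?_ (hen n)
      have := ENNReal.toReal_mono (measure_ne_top _ _) h1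
      rwa [ENNReal.toReal_mul, ENNReal.toReal_ofReal (by positivity)] at this
    have h3 : μ.real (bad n) ≤ K / M * ω ^ n := by
      have hσn : 0 < M * σ ^ n := by positivity
      refine le_of_mul_le_mul_left (h2.trans (le_of_eq ?_)) hσn
      rw [mul_pow]; field_simp
    rw [← ENNReal.ofReal_toReal (measure_ne_top μ (bad n))]
    exact ENNReal.ofReal_le_ofReal h3
  have hbadU : μ (⋃ n, bad n) ≤ ENNReal.ofReal (1 / 2) := by
    calc μ (⋃ n, bad n) ≤ ∑' n, μ (bad n) := measure_iUnion_le _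
      _ ≤ ∑' n, ENNReal.ofReal (K / M * ω ^ n) := ENNReal.tsum_le_tsum hbad
      _ = ENNReal.ofReal (∑' n, K / M * ω ^ n) :=
        (ENNReal.ofReal_tsum_of_nonneg (fun n => by positivity)
          ((summable_geometric_of_lt_one hω0.le hω1).mul_left _)).symm
      _ = ENNReal.ofReal (1 / 2) := by
        rw [tsum_mul_left, tsum_geometric_of_lt_one hω0.le hω1, hM]
        have : 1 - ω ≠ 0 := by linarith
        congr 1; field_simp
  -- The extra 1 covers radii r ≥ 1, where the total mass is at most 1.
  refine ⟨M + 1, by positivity, E \ ⋃ n, bad n,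
    hE.isCompact.isClosed.measurableSet.diff (MeasurableSet.iUnion hbadmeas),
    Set.sdiff_subset, ?_, ?_⟩
  · by_contra! h0
    have h1 : (1 : ENNReal) ≤ ENNReal.ofReal (1 / 2) := by
      calc (1 : ENNReal) = μ Set.univ := measure_univ.symm
        _ ≤ μ ((E \ ⋃ n, bad n) ∪ (Eᶜ ∪ ⋃ n, bad n)) :=
          measure_mono fun x _ => by
            by_cases hx : x ∈ E <;> by_cases hx' : x ∈ ⋃ n, bad n <;> simp_all
        _ ≤ μ (E \ ⋃ n, bad n) + (μ Eᶜ + μ (⋃ n, bad n)) :=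
          (measure_union_le _ _).trans (by gcongr; exact measure_union_le _ _)
        _ ≤ 0 + (0 + ENNReal.ofReal (1 / 2)) := by
          gcongr; exact hE.measure_compl.le
        _ = _ := by simp
    rw [← ENNReal.ofReal_one, ENNReal.ofReal_le_ofReal_iff (by norm_num)] at h1
    norm_num at h1
  · intro x r hr
    rcases le_or_gt 1 r with hr1 | hr1
    · calc _ ≤ (μ.restrict (E \ ⋃ n, bad n)) Set.univ := measure_mono (Set.subset_univ _)
        _ ≤ μ Set.univ := Measure.restrict_apply_le _ _
        _ = ENNReal.ofReal 1 := by simp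
        _ ≤ _ := by
          refine ENNReal.ofReal_le_ofReal ?_
          have := Real.one_le_rpow hr1 hα
          nlinarith
    obtain ⟨m, hm⟩ : ∃ m : ℕ, ((q : ℝ) ^ (m + 1))⁻¹ ≤ r ∧ r < ((q : ℝ) ^ m)⁻¹ := by
      have hex : ∃ m : ℕ, ((q : ℝ) ^ m)⁻¹ ≤ r := by
        obtain ⟨m, hm⟩ := exists_pow_lt_of_lt_one hr (inv_lt_one_of_one_lt₀ hq1)
        exact ⟨m, by rw [← inv_pow]; exact hm.le⟩
      classical
      have hspec := Nat.find_spec hex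
      have hmin := fun m hm => Nat.find_min hex (m := m) hm
      rcases hfind : Nat.find hex with _ | m
      · rw [hfind] at hspec
        norm_num at hspec
        linarith
      · rw [hfind] at hspec
        refine ⟨m, hspec, ?_⟩
        exact not_le.1 (hmin m (by omega))
    have hballmeas : ∀ y, y ∈ ball x r → x - y ∈ vanishingBelow q (m + 1) := fun y hy =>
      sub_mem_vanishingBelow_comm
        (mem_vanishingBelow_of_absVal_lt hq1' (lt_of_le_of_lt hy hm.2))
    have hsubset : ball x r ⊆ cell (m + 1) x := hballmeas
    have hcell : MeasurableSet (cell (m + 1) x) :=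
      measurable_prodMk_left (measurableSet_prod_sub_mem (m + 1))
    calc (μ.restrict (E \ ⋃ n, bad n)) (ball x r)
        ≤ (μ.restrict (E \ ⋃ n, bad n)) (cell (m + 1) x) := measure_mono hsubset
      _ = μ (cell (m + 1) x ∩ (E \ ⋃ n, bad n)) := Measure.restrict_apply hcell
      _ ≤ ENNReal.ofReal (M * σ ^ (m + 1)) := by
        -- The cell of any surviving point `y` in the cell of `x` is that same cell, so the bound at
        -- `y` transfers to `x`.
        rcases Set.eq_empty_or_nonempty (cell (m + 1) x ∩ (E \ ⋃ n, bad n)) with he | ⟨y, hyc, hyE⟩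
        · simp [he]
        · have hy : y ∉ bad (m + 1) := fun hy => hyE.2 (Set.mem_iUnion.2 ⟨_, hy⟩)
          refine le_trans (measure_mono fun z hz => ?_) (not_le.1 hy).le
          intro i hi
          have h1 := hz.1 i hi
          have h2 := hyc i hi
          simp only [Pi.sub_apply, sub_eq_zero] at h1 h2 ⊢
          exact h2.symm.trans h1
      _ ≤ _ := by
        refine ENNReal.ofReal_le_ofReal ?_
        have h1 : σ ^ (m + 1) ≤ r ^ α := by
          have : σ ^ (m + 1) = (((q : ℝ) ^ (m + 1))⁻¹) ^ α := by
            rw [Real.inv_rpow (by positivity), ← Real.rpow_neg (by positivity), hσ,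
              Real.rpow_pow_comm hq0.le]
          rw [this]
          exact Real.rpow_le_rpow (by positivity) hm.1 hα
        have h2 : 0 ≤ r ^ α := by positivity
        nlinarith

end Energy

end FqInf

namespace FqInf

/-! ### The trilinear form -/

section Trilinear

variable {q : ℕ}

/-- The first `n` components. -/
def truncate (n : ℕ) (x : FqInf q) : Fin n → ZMod q := fun i => x i

theorem measurable_truncate (n : ℕ) : Measurable (truncate (q := q) n) :=
  measurable_pi_lambda _ fun i => measurable_pi_apply (i : ℕ)

variable [Fact q.Prime]

/-- The triples that form a progression up to level `N` with difference nonzero at level `n`. -/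
def approxAPs (q n N : ℕ) : Set (FqInf q × FqInf q × FqInf q) :=
  {p | p.1 - (p.2.1 + p.2.1) + p.2.2 ∈ vanishingBelow q N ∧ p.1 - p.2.1 ∉ vanishingBelow q n}

theorem measurableSet_approxAPs (n N : ℕ) : MeasurableSet (approxAPs q n N) := by
  have h1 : Measurable fun p : FqInf q × FqInf q × FqInf q => p.1 - (p.2.1 + p.2.1) + p.2.2 := by
    fun_prop
  have h2 : Measurable fun p : FqInf q × FqInf q × FqInf q => p.1 - p.2.1 := by
    fun_prop
  exact (h1 (measurableSet_vanishingBelow N)).inter (h2 (measurableSet_vanishingBelow n)).compl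

theorem isClosed_approxAPs (n N : ℕ) : IsClosed (approxAPs q n N) := by
  have h1 : Continuous fun p : FqInf q × FqInf q × FqInf q => p.1 - (p.2.1 + p.2.1) + p.2.2 := by
    fun_prop
  have h2 : Continuous fun p : FqInf q × FqInf q × FqInf q => p.1 - p.2.1 := by
    fun_prop
  exact ((isClopen_vanishingBelow N).1.preimage h1).inter
    ((isClopen_vanishingBelow n).compl.1.preimage h2)

/-- The integral of `χ_ξ(x - 2y + z) χ_η(x - y)` against `μ × μ × μ`. -/
noncomputable def twistedCoeff (μ : Measure (FqInf q)) (ξ η : FqInfDual q) : ℂ :=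
  fourierTransform μ (ξ + η) * (fourierTransform μ (-(ξ + ξ) - η) * fourierTransform μ ξ)

theorem twistedCoeff_eq_integral (μ : Measure (FqInf q)) [IsProbabilityMeasure μ]
    (ξ η : FqInfDual q) : twistedCoeff μ ξ η =
      ∫ p : FqInf q × FqInf q × FqInf q,
        char ξ (p.1 - (p.2.1 + p.2.1) + p.2.2) * char η (p.1 - p.2.1) ∂(μ.prod (μ.prod μ)) := by
  rw [twistedCoeff, fourierTransform_eq, fourierTransform_eq, fourierTransform_eq,
    ← integral_prod_mul, ← integral_prod_mul]
  refine integral_congr_ae (.of_forall fun p => ?_)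
  simp only [sub_eq_add_neg, neg_add, char_add_right, char_neg_right, char_add_left]
  ring

theorem integrable_char_mul_char (μ : Measure (FqInf q)) [IsProbabilityMeasure μ]
    (ξ η : FqInfDual q) : Integrable (fun p : FqInf q × FqInf q × FqInf q =>
      char ξ (p.1 - (p.2.1 + p.2.1) + p.2.2) * char η (p.1 - p.2.1)) (μ.prod (μ.prod μ)) := by
  refine Integrable.of_bound (Measurable.aestronglyMeasurable ?_) 1 (.of_forall fun p => ?_)
  · exact ((measurable_char ξ).comp (by fun_prop)).mul ((measurable_char η).comp (by fun_prop))
  · rw [norm_mul, norm_char, norm_char, one_mul]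

/-- The coefficient at `ξ` of the trilinear form counting progressions whose difference is nonzero
at level `n`. -/
noncomputable def tripleCoeff (μ : Measure (FqInf q)) (n : ℕ) (ξ : FqInfDual q) : ℂ :=
  twistedCoeff μ ξ 0 - ((q : ℂ) ^ n)⁻¹ * ∑ η ∈ dualBelow q n, twistedCoeff μ ξ η

/-- The average over η is the indicator that x - y vanishes below `n`, and `tripleCoeff` subtracts
it from 1. The sum over ξ then detects x - 2y + z. -/
theorem sum_tripleCoeff (μ : Measure (FqInf q)) [IsProbabilityMeasure μ] (n N : ℕ) :
    ∑ ξ ∈ dualBelow q N, tripleCoeff μ n ξ =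
      ((q : ℂ) ^ N) * ((μ.prod (μ.prod μ)).real (approxAPs q n N) : ℝ) := by
  classical
  have hq0 : (q : ℂ) ^ n ≠ 0 := pow_ne_zero _ (by exact_mod_cast (Fact.out : q.Prime).ne_zero)
  let F : FqInfDual q → FqInf q × FqInf q × FqInf q → ℂ := fun ξ p =>
    char ξ (p.1 - (p.2.1 + p.2.1) + p.2.2) * char 0 (p.1 - p.2.1) -
      ((q : ℂ) ^ n)⁻¹ * ∑ η ∈ dualBelow q n,
        char ξ (p.1 - (p.2.1 + p.2.1) + p.2.2) * char η (p.1 - p.2.1)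
  have hint : ∀ ξ, Integrable (F ξ) (μ.prod (μ.prod μ)) := fun ξ =>
    (integrable_char_mul_char μ ξ 0).sub
      ((integrable_finsetSum _ fun η _ => integrable_char_mul_char μ ξ η).const_mul _)
  have h1 : ∀ ξ, tripleCoeff μ n ξ = ∫ p, F ξ p ∂(μ.prod (μ.prod μ)) := by
    intro ξ
    rw [tripleCoeff, twistedCoeff_eq_integral,
      Finset.sum_congr rfl fun η _ => twistedCoeff_eq_integral μ ξ η,
      ← integral_finsetSum _ fun η _ => integrable_char_mul_char μ ξ η, ← integral_const_mul,
      ← integral_sub (integrable_char_mul_char μ ξ 0)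
        ((integrable_finsetSum _ fun η _ => integrable_char_mul_char μ ξ η).const_mul _)]
  rw [Finset.sum_congr rfl fun ξ _ => h1 ξ, ← integral_finsetSum _ fun ξ _ => hint ξ]
  have h2 : ∀ p, ∑ ξ ∈ dualBelow q N, F ξ p =
      Set.indicator (approxAPs q n N) (fun _ => (q : ℂ) ^ N) p := by
    intro p
    have h3 : ∀ ξ, F ξ p = char ξ (p.1 - (p.2.1 + p.2.1) + p.2.2) *
        (1 - ((q : ℂ) ^ n)⁻¹ * ∑ η ∈ dualBelow q n, char η (p.1 - p.2.1)) := by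
      intro ξ
      have : char (0 : FqInfDual q) (p.1 - p.2.1) = 1 := by
        simp [char, pairing]
      simp only [F, this, ← Finset.mul_sum]
      ring
    rw [Finset.sum_congr rfl fun ξ _ => h3 ξ, ← Finset.sum_mul, sum_char_dualBelow,
      sum_char_dualBelow, Set.indicator_apply]
    simp only [approxAPs, Set.mem_ofPred_eq]
    by_cases ha : p.1 - (p.2.1 + p.2.1) + p.2.2 ∈ vanishingBelow q N <;>
      by_cases hb : p.1 - p.2.1 ∈ vanishingBelow q n <;> simp [ha, hb, hq0]
  simp only [h2]
  rw [integral_indicator_const _ (measurableSet_approxAPs n N), Complex.real_smul, mul_comm]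

theorem two_mul_ne_zero_of_odd (hq : Odd q) {c : ZMod q} (hc : c ≠ 0) : c + c ≠ 0 := by
  rw [← two_mul]
  refine mul_ne_zero (fun h => ?_) hc
  have h2 := (ZMod.natCast_eq_zero_iff 2 q).1 (by exact_mod_cast h)
  have := Nat.le_of_dvd two_pos h2
  have := (Fact.out : q.Prime).two_le
  obtain rfl : q = 2 := by omega
  exact absurd hq (by decide)

/-- Since n ≤ j, a twist by η does not touch coordinate `j`. So ξ + η, -2ξ - η and ξ all have last
nonzero index `j`, the second because q is odd, and decay applies to all three factors. -/
theorem norm_tripleCoeff_le (hq : Odd q) {μ : Measure (FqInf q)} {B : ℝ} {n j : ℕ} (hnj : n ≤ j)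
    (hB : ∀ ξ ∈ dualBelow q (j + 1), ξ j ≠ 0 → ‖fourierTransform μ ξ‖ ≤ B) (ξ : FqInfDual q)
    (hξ : ξ ∈ dualBelow q (j + 1)) (hj : ξ j ≠ 0) : ‖tripleCoeff μ n ξ‖ ≤ 2 * B ^ 3 := by
  have hq0 : (0 : ℝ) < (q : ℝ) ^ n :=
    pow_pos (by exact_mod_cast (Fact.out : q.Prime).pos) _
  have hB0 : 0 ≤ B := (norm_nonneg _).trans (hB ξ hξ hj)
  have htw : ∀ η ∈ dualBelow q n, ‖twistedCoeff μ ξ η‖ ≤ B ^ 3 := by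
    intro η hη
    have hηj : η j = 0 := mem_dualBelow.1 hη j hnj
    have hη' := mem_dualBelow.1 (dualBelow_mono (hnj.trans j.le_succ) hη)
    have hξ' := mem_dualBelow.1 hξ
    have e1 : ‖fourierTransform μ (ξ + η)‖ ≤ B :=
      hB _ (mem_dualBelow.2 fun i hi => by simp [hξ' i hi, hη' i hi]) (by simpa [hηj] using hj)
    have e2 : ‖fourierTransform μ (-(ξ + ξ) - η)‖ ≤ B := by
      refine hB _ (mem_dualBelow.2 fun i hi => by simp [hξ' i hi, hη' i hi]) ?_
      have : (-(ξ + ξ) - η) j = -(ξ j + ξ j) := by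
        rw [Finsupp.sub_apply, Finsupp.neg_apply, Finsupp.add_apply, hηj, sub_zero]
      rw [this]
      exact neg_ne_zero.2 (two_mul_ne_zero_of_odd hq hj)
    rw [twistedCoeff, norm_mul, norm_mul]
    calc _ ≤ B * (B * B) := mul_le_mul e1 (mul_le_mul e2 (hB ξ hξ hj) (norm_nonneg _) hB0)
          (by positivity) hB0
      _ = B ^ 3 := by ring
  have hsum : ‖((q : ℂ) ^ n)⁻¹ * ∑ η ∈ dualBelow q n, twistedCoeff μ ξ η‖ ≤ B ^ 3 := by
    rw [norm_mul, norm_inv, norm_pow, Complex.norm_natCast, inv_mul_le_iff₀ hq0]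
    refine (norm_sum_le_of_le _ htw).trans (le_of_eq ?_)
    simp [card_dualBelow]
  have h0 := htw 0 (mem_dualBelow.2 fun _ _ => rfl)
  calc _ ≤ _ := norm_sub_le _ _
    _ ≤ B ^ 3 + B ^ 3 := add_le_add h0 hsum
    _ = _ := by ring

/-- Without progressions in `E`, approximate progressions in `E` of a high level have differences
that vanish at level `n`. -/
theorem exists_level_of_not_hasThreeTermAP {E : Set (FqInf q)} (hE : IsCompact E)
    (hAP : ¬ HasThreeTermAP E) (n : ℕ) :
    ∃ N, n ≤ N ∧ E ×ˢ (E ×ˢ E) ∩ approxAPs q n N = ∅ := by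
  by_contra! hne
  have hEc : IsCompact (E ×ˢ (E ×ˢ E)) := hE.prod (hE.prod hE)
  obtain ⟨p, hp⟩ := IsCompact.nonempty_iInter_of_sequence_nonempty_isCompact_isClosed
    (fun k => E ×ˢ (E ×ˢ E) ∩ approxAPs q n (n + k))
    (fun k p hp => ⟨hp.1, vanishingBelow_anti (by omega) hp.2.1, hp.2.2⟩)
    (fun k => hne (n + k) (Nat.le_add_right n k))
    (hEc.inter_right (isClosed_approxAPs n _))
    (fun k => hEc.isClosed.inter (isClosed_approxAPs n _))
  rw [Set.mem_iInter] at hp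
  have hpE := (hp 0).1
  have hzero : p.1 - (p.2.1 + p.2.1) + p.2.2 = 0 := by
    funext i
    exact (hp (i + 1)).2.1 i (by omega)
  refine hAP ⟨p.1, p.2.1 - p.1, fun h => ?_, hpE.1, ?_, ?_⟩
  · refine (hp 0).2.2 fun i _ => ?_
    rw [sub_eq_zero.1 h, sub_self]
    rfl
  · rw [add_sub_cancel]
    exact hpE.2.1
  · have : p.1 + 2 • (p.2.1 - p.1) = p.2.2 := by
      rw [← sub_eq_zero, ← neg_eq_zero, ← hzero, two_nsmul]
      abel
    rw [this]
    exact hpE.2.2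

theorem CompactCarrier.measure_prod_eq_zero {E : Set (FqInf q)} {μ : Measure (FqInf q)}
    (hE : CompactCarrier E μ) {T : Set (FqInf q × FqInf q × FqInf q)}
    (hT : E ×ˢ (E ×ˢ E) ∩ T = ∅) : (μ.prod (μ.prod μ)) T = 0 := by
  have := hE.isProbabilityMeasure
  refine measure_mono_null (t := (Eᶜ ×ˢ Set.univ) ∪ (Set.univ ×ˢ (Eᶜ ×ˢ Set.univ)) ∪
    (Set.univ ×ˢ (Set.univ ×ˢ Eᶜ))) (fun p hp => ?_) ?_
  · by_contra h
    have : p ∈ E ×ˢ (E ×ˢ E) ∩ T := by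
      simp only [Set.mem_union, Set.mem_prod, Set.mem_compl_iff, Set.mem_univ, and_true, true_and,
        not_or, not_not] at h
      exact ⟨⟨h.1.1, h.1.2, h.2⟩, hp⟩
    rw [hT] at this
    exact this
  · simp [measure_union_null_iff, Measure.prod_prod, hE.measure_compl]

/-- The full sum vanishes at some level `N`, so the sum at level `n` equals minus the shells between
`n` and `N`. These are bounded by a geometric series whose ratio is less than 1 exactly because β >
2/3. -/
theorem exists_approxAPs_le (hq : Odd q) {E : Set (FqInf q)} {μ : Measure (FqInf q)}
    (hE : CompactCarrier E μ) (hAP : ¬ HasThreeTermAP E) {β : ℝ} (hβ : 2 / 3 < β)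
    (h : FourierDecay μ β) : ∃ K : ℝ, 0 < K ∧ ∀ n,
      (q : ℝ) ^ n * (μ.prod (μ.prod μ)).real (approxAPs q n n) ≤
        K * ((q : ℝ) ^ (1 - 3 * β / 2)) ^ n := by
  have := hE.isProbabilityMeasure
  obtain ⟨C, hC, hdec⟩ := h.exists_bound
  have hq1 : (1 : ℝ) < q := by exact_mod_cast (Fact.out : q.Prime).one_lt
  have hq0 : (0 : ℝ) < q := by linarith
  set θ : ℝ := (q : ℝ) ^ (1 - 3 * β / 2) with hθ
  have hθ0 : 0 < θ := Real.rpow_pos_of_pos hq0 _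
  have hθ1 : θ < 1 := Real.rpow_lt_one_of_one_lt_of_neg hq1 (by linarith)
  have h1θ : 0 < 1 - θ := by linarith
  refine ⟨2 * C ^ 3 * (1 - θ)⁻¹, by positivity, fun n => ?_⟩
  obtain ⟨N, hnN, hN⟩ := exists_level_of_not_hasThreeTermAP hE.isCompact hAP n
  have hzero : ∑ ξ ∈ dualBelow q N, tripleCoeff μ n ξ = 0 := by
    rw [sum_tripleCoeff, measureReal_def, hE.measure_prod_eq_zero hN]
    simp
  have hbd := norm_sum_dualBelow_sub_le (f := tripleCoeff μ n)
    (b := fun j => 2 * (C * ((q : ℝ) ^ (j + 1)) ^ (-β / 2)) ^ 3) hnN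
    fun j hnj ξ hξ hj => norm_tripleCoeff_le hq hnj (hdec j) ξ hξ hj
  have hpow : ∀ j : ℕ, (q : ℝ) ^ (j + 1) * |2 * (C * ((q : ℝ) ^ (j + 1)) ^ (-β / 2)) ^ 3| =
      2 * C ^ 3 * θ ^ (j + 1) := by
    intro j
    have hx : (0 : ℝ) < (q : ℝ) ^ (j + 1) := by positivity
    have e1 : θ ^ (j + 1) = ((q : ℝ) ^ (j + 1)) ^ (1 - 3 * β / 2) := by
      rw [hθ, Real.rpow_pow_comm hq0.le]
    have e2 : (((q : ℝ) ^ (j + 1)) ^ (-β / 2)) ^ 3 = ((q : ℝ) ^ (j + 1)) ^ (-(3 * β / 2)) := by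
      rw [← Real.rpow_mul_natCast hx.le]; congr 1; push_cast; ring
    rw [abs_of_nonneg (by positivity), mul_pow, e2, e1,
      show (1 - 3 * β / 2) = 1 + -(3 * β / 2) by ring, Real.rpow_add hx, Real.rpow_one]
    ring
  rw [hzero, zero_sub, norm_neg, sum_tripleCoeff, norm_mul, norm_pow, Complex.norm_natCast,
    Complex.norm_real, Real.norm_of_nonneg measureReal_nonneg,
    Finset.sum_congr rfl fun j _ => hpow j, ← Finset.mul_sum] at hbd
  refine hbd.trans ?_
  rw [mul_assoc (2 * C ^ 3)]
  refine mul_le_mul_of_nonneg_left ?_ (by positivity)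
  have hgeo : ∑ j ∈ Finset.Ico n N, θ ^ (j + 1) ≤ ∑ j ∈ Finset.Ico n N, θ ^ j :=
    Finset.sum_le_sum fun j _ => pow_le_pow_of_le_one hθ0.le hθ1.le (Nat.le_succ j)
  have hgeo2 := geom_sum_Ico_le_of_lt_one (m := n) (n := N) hθ0.le hθ1
  refine (hgeo.trans hgeo2).trans (le_of_eq ?_)
  rw [div_eq_mul_inv, mul_comm]

/-- Each nontrivial progression of cells gives a box of mass at least w³ inside `approxAPs q n n`,
and the boxes are disjoint. -/
theorem sum_mul_le_approxAPs (μ : Measure (FqInf q)) [IsProbabilityMeasure μ] {n : ℕ}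
    (A : Finset (Fin n → ZMod q)) {w : ℝ} (hw : 0 ≤ w)
    (hA : ∀ i ∈ A, w ≤ μ.real (truncate n ⁻¹' {i})) :
    (((apPairs A).filter fun p => p.2 ≠ 0).card : ℝ) * w ^ 3 ≤
      (μ.prod (μ.prod μ)).real (approxAPs q n n) := by
  classical
  let P := (apPairs A).filter fun p => p.2 ≠ 0
  let cell : (Fin n → ZMod q) → Set (FqInf q) := fun i => truncate n ⁻¹' {i}
  have hcell : ∀ i, MeasurableSet (cell i) := fun i =>
    measurable_truncate n (measurableSet_singleton i)
  let box : (Fin n → ZMod q) × (Fin n → ZMod q) → Set (FqInf q × FqInf q × FqInf q) := fun p =>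
    cell p.1 ×ˢ (cell (p.1 + p.2) ×ˢ cell (p.1 + 2 • p.2))
  have hbox : ∀ p, MeasurableSet (box p) := fun p => (hcell _).prod ((hcell _).prod (hcell _))
  have hdisj : Set.PairwiseDisjoint (P : Set ((Fin n → ZMod q) × (Fin n → ZMod q))) box := by
    intro p _ p' _ hpp
    refine Set.disjoint_left.2 fun t ht ht' => hpp ?_
    have h1 : p.1 = p'.1 := (ht.1 : truncate n t.1 = p.1).symm.trans ht'.1
    have h2 : p.1 + p.2 = p'.1 + p'.2 :=
      (ht.2.1 : truncate n t.2.1 = p.1 + p.2).symm.trans ht'.2.1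
    rw [h1] at h2
    exact Prod.ext h1 (add_left_cancel h2)
  have hsub : ⋃ p ∈ P, box p ⊆ approxAPs q n n := by
    intro t ht
    simp only [Set.mem_iUnion] at ht
    obtain ⟨p, hp, ht⟩ := ht
    have h1 : truncate n t.1 = p.1 := ht.1
    have h2 : truncate n t.2.1 = p.1 + p.2 := ht.2.1
    have h3 : truncate n t.2.2 = p.1 + 2 • p.2 := ht.2.2
    refine ⟨fun i hi => ?_, fun hv => (Finset.mem_filter.1 hp).2 ?_⟩
    · have e1 := congrFun h1 ⟨i, hi⟩
      have e2 := congrFun h2 ⟨i, hi⟩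
      have e3 := congrFun h3 ⟨i, hi⟩
      simp only [truncate, Pi.add_apply, two_nsmul] at e1 e2 e3
      simp only [Pi.add_apply, Pi.sub_apply, e1, e2, e3]
      ring
    · funext i
      have e1 := congrFun h1 i
      have e2 := congrFun h2 i
      have := hv i i.2
      simp only [truncate, Pi.add_apply] at e1 e2
      simp only [Pi.sub_apply, e1, e2] at this
      simpa using this
  calc (P.card : ℝ) * w ^ 3 = ∑ _p ∈ P, w ^ 3 := by simp
    _ ≤ ∑ p ∈ P, (μ.prod (μ.prod μ)).real (box p) := by
      refine Finset.sum_le_sum fun p hp => ?_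
      have hp' := mem_apPairs.1 (Finset.mem_filter.1 hp).1
      simp only [box, measureReal_prod_prod]
      calc w ^ 3 = w * (w * w) := by ring
        _ ≤ _ := mul_le_mul (hA _ hp'.1)
          (mul_le_mul (hA _ hp'.2.1) (hA _ hp'.2.2) hw measureReal_nonneg)
          (by positivity) measureReal_nonneg
    _ = (μ.prod (μ.prod μ)).real (⋃ p ∈ P, box p) :=
      (measureReal_biUnion_finset hdisj fun p _ => hbox p).symm
    _ ≤ _ := measureReal_mono hsub

end Trilinear

end FqInf

/-! ### Nontrivial progressions in dense subsets of a finite vector space -/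

section SupersaturationBound

/-- A dense enough set has a positive proportion (in terms of the codimension `d`) of
nontrivial progressions. -/
theorem le_card_apPairs_ne_zero {K V : Type*} [Field K] [Fintype K] [AddCommGroup V] [Module K V]
    [Fintype V] [DecidableEq V] {d : ℕ} {M : ℝ}
    (hM : ∀ A : Finset (Fin d → K), ThreeAPFree (A : Set (Fin d → K)) → (A.card : ℝ) ≤ M)
    (A : Finset V)
    (hdense : 4 * M * Fintype.card V ≤ A.card * (Fintype.card K : ℝ) ^ d)
    (hd : 4 * (Fintype.card K : ℝ) ^ d ≤ Fintype.card V) :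
    (Fintype.card V : ℝ) * A.card ≤
      2 * (Fintype.card K : ℝ) ^ d * ((apPairs A).filter fun p => p.2 ≠ 0).card := by
  classical
  have hsup := supersaturation hM A
  have htriv : (apPairs A).card ≤ ((apPairs A).filter fun p => p.2 ≠ 0).card + A.card := by
    rw [← Finset.card_filter_add_card_filter_not (s := apPairs A) (fun p => p.2 ≠ 0)]
    refine Nat.add_le_add_left (Finset.card_le_card_of_injOn Prod.fst (fun p hp => ?_) ?_) _
    · exact (mem_apPairs.1 (Finset.mem_filter.1 hp).1).1
    · intro p hp p' hp' h
      have h1 := (Finset.mem_filter.1 hp).2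
      have h2 := (Finset.mem_filter.1 hp').2
      exact Prod.ext h ((not_not.1 h1).trans (not_not.1 h2).symm)
  have htriv' : ((apPairs A).card : ℝ) ≤ ((apPairs A).filter fun p => p.2 ≠ 0).card + A.card := by
    exact_mod_cast htriv
  have hV : (0 : ℝ) < Fintype.card V := by exact_mod_cast Fintype.card_pos
  have hQ : (0 : ℝ) < (Fintype.card K : ℝ) ^ d := by
    have : 0 < Fintype.card K := Fintype.card_pos
    positivity
  generalize (((apPairs A).filter fun p => p.2 ≠ 0).card : ℝ) = T at *
  generalize ((apPairs A).card : ℝ) = S at *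
  generalize (Fintype.card V : ℝ) = N at *
  generalize (Fintype.card K : ℝ) ^ d = Q at *
  have ha : (0 : ℝ) ≤ A.card := Nat.cast_nonneg _
  generalize (A.card : ℝ) = a at *
  refine le_of_mul_le_mul_left ?_ hQ
  have h1 : Q ^ 2 * S ≤ Q ^ 2 * (T + a) := mul_le_mul_of_nonneg_left htriv' (by positivity)
  have h2 : 4 * M * N * N ≤ a * Q * N := mul_le_mul_of_nonneg_right hdense hV.le
  have h3 : 4 * Q * (Q * a) ≤ N * (Q * a) := mul_le_mul_of_nonneg_right hd (by positivity)
  -- The error M N² and the trivial progressions Q² a each cost at most a quarter of N a Q, so half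
  -- of it remains.
  nlinarith

end SupersaturationBound

/-! ### Comparison of the upper and lower bounds at one scale -/

namespace FqInf

section Main

variable {q : ℕ} [Fact q.Prime]

theorem exists_powerSaving (hq : Odd q) : ∃ c : ℝ, 0 < c ∧ c ≤ 1 ∧
    ∀ (d : ℕ) (A : Finset (Fin d → ZMod q)), ThreeAPFree (A : Set (Fin d → ZMod q)) →
      (A.card : ℝ) ≤ 3 * (q : ℝ) ^ ((1 - c) * d) := by
  obtain ⟨ρ, hρ0, hρq, hρ⟩ := exists_threeAPFree_card_le (q := q) hq
  have hq1 : (1 : ℝ) < q := by exact_mod_cast (Fact.out : q.Prime).one_lt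
  refine ⟨min 1 (1 - Real.logb q ρ), lt_min one_pos ?_, min_le_left _ _, fun d A hA => ?_⟩
  · rw [sub_pos, Real.logb_lt_iff_lt_rpow hq1 hρ0, Real.rpow_one]
    exact hρq
  · refine (hρ d A hA).trans ?_
    rw [Real.rpow_mul_natCast (by linarith)]
    have : ρ ≤ (q : ℝ) ^ (1 - min 1 (1 - Real.logb q ρ)) := by
      rw [← Real.logb_le_iff_le_rpow hq1 hρ0]
      linarith [min_le_right 1 (1 - Real.logb q ρ)]
    gcongr

theorem FourierDecay.mono {μ : Measure (FqInf q)} {β β' : ℝ} (h : FourierDecay μ β)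
    (hβ : β' ≤ β) : FourierDecay μ β' := by
  obtain ⟨C, hC, hdec⟩ := h
  have hq1 : (1 : ℝ) ≤ q := by exact_mod_cast (Fact.out : q.Prime).one_lt.le
  refine ⟨C, hC, fun ξ hξ => (hdec ξ hξ).trans (mul_le_mul_of_nonneg_left ?_ hC.le)⟩
  refine Real.rpow_le_rpow_of_exponent_le ?_ (by linarith)
  rw [dualAbsVal, if_neg hξ]
  exact one_le_pow₀ hq1

/-- The fibres of the truncation that carry mass at least half of the average are numerous. -/
theorem exists_heavy_cells {μ : Measure (FqInf q)} [IsProbabilityMeasure μ] {E' : Set (FqInf q)}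
    (hE' : MeasurableSet E') {n : ℕ} {P : ℝ}
    (hP : ∀ i, μ.real (E' ∩ truncate n ⁻¹' {i}) ≤ P) :
    ∃ A : Finset (Fin n → ZMod q), μ.real E' ≤ 2 * (A.card * P) ∧
      ∀ i ∈ A, μ.real E' / (2 * (q : ℝ) ^ n) ≤ μ.real (truncate n ⁻¹' {i}) := by
  classical
  set m := μ.real E' with hm
  have hqn : (0 : ℝ) < (q : ℝ) ^ n := pow_pos (by exact_mod_cast (Fact.out : q.Prime).pos) _
  let p : (Fin n → ZMod q) → ℝ := fun i => μ.real (E' ∩ truncate n ⁻¹' {i})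
  have hsum : m = ∑ i, p i := by
    have hU : E' = ⋃ i ∈ (Finset.univ : Finset (Fin n → ZMod q)), E' ∩ truncate n ⁻¹' {i} := by
      ext x; simp
    rw [hm]
    nth_rw 1 [hU]
    refine measureReal_biUnion_finset (fun i _ j _ hij => ?_) fun i _ =>
      hE'.inter (measurable_truncate n (measurableSet_singleton i))
    refine Set.disjoint_left.2 fun x hx hx' => hij ?_
    exact (hx.2 : truncate n x = i).symm.trans hx'.2
  refine ⟨Finset.univ.filter fun i => m / (2 * (q : ℝ) ^ n) ≤ p i, ?_, fun i hi => ?_⟩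
  · rw [← Finset.sum_filter_add_sum_filter_not _ fun i => m / (2 * (q : ℝ) ^ n) ≤ p i] at hsum
    have h1 : ∑ i with m / (2 * (q : ℝ) ^ n) ≤ p i, p i ≤
        (Finset.univ.filter fun i => m / (2 * (q : ℝ) ^ n) ≤ p i).card * P := by
      rw [← nsmul_eq_mul]
      exact Finset.sum_le_card_nsmul _ _ _ fun i _ => hP i
    -- There are only q^n cells, so the light ones carry at most half of the mass.
    have h2 : ∑ i with ¬ m / (2 * (q : ℝ) ^ n) ≤ p i, p i ≤ m / 2 := by
      calc _ ≤ ∑ i with ¬ m / (2 * (q : ℝ) ^ n) ≤ p i, m / (2 * (q : ℝ) ^ n) :=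
            Finset.sum_le_sum fun i hi => (not_le.1 (Finset.mem_filter.1 hi).2).le
        _ ≤ ∑ i : Fin n → ZMod q, m / (2 * (q : ℝ) ^ n) :=
            Finset.sum_le_sum_of_subset_of_nonneg (Finset.filter_subset _ _) fun _ _ _ =>
              div_nonneg measureReal_nonneg (by positivity)
        _ = m / 2 := by
            simp [ZMod.card]; field_simp
    linarith
  · exact (Finset.mem_filter.1 hi).2.trans (measureReal_mono Set.inter_subset_right)

theorem BallCondition.measureReal_cell_le {μ : Measure (FqInf q)} {E' : Set (FqInf q)} {C α : ℝ}
    (hC : 0 < C) (h : BallCondition (μ.restrict E') C α) (n : ℕ) (i : Fin n → ZMod q) :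
    μ.real (E' ∩ truncate n ⁻¹' {i}) ≤ C * (q : ℝ) ^ (-(α * n)) := by
  have hq0 : (0 : ℝ) < q := by exact_mod_cast (Fact.out : q.Prime).pos
  have hqn : (0 : ℝ) < ((q : ℝ) ^ n)⁻¹ := by positivity
  let x : FqInf q := fun k => if hk : k < n then i ⟨k, hk⟩ else 0
  have hsub : truncate n ⁻¹' {i} ⊆ ball x ((q : ℝ) ^ n)⁻¹ := by
    intro y hy
    refine absVal_le_of_mem_vanishingBelow (Fact.out : q.Prime).pos fun k hk => ?_
    have := congrFun (hy : truncate n y = i) ⟨k, hk⟩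
    simp only [truncate] at this
    simp [x, hk, this]
  have hb := (measure_mono hsub).trans (h x _ hqn)
  rw [Measure.restrict_apply (measurable_truncate n (measurableSet_singleton i)),
    Set.inter_comm] at hb
  have e : (((q : ℝ) ^ n)⁻¹) ^ α = (q : ℝ) ^ (-(α * n)) := by
    rw [Real.inv_rpow (by positivity), ← Real.rpow_natCast, ← Real.rpow_mul hq0.le,
      ← Real.rpow_neg hq0.le, mul_comm]
  rw [e] at hb
  exact ENNReal.toReal_le_of_le_ofReal (by positivity) hb

theorem eventually_rpow_mul_lt {x : ℝ} (hx : 1 < x) {a ε : ℝ} (ha : a < 0) (hε : 0 < ε) :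
    ∀ᶠ n : ℕ in Filter.atTop, x ^ (a * n) < ε := by
  have h1 : x ^ a < 1 := Real.rpow_lt_one_of_one_lt_of_neg hx ha
  have h0 : 0 ≤ x ^ a := Real.rpow_nonneg (by linarith) _
  filter_upwards [(tendsto_pow_atTop_nhds_zero_of_lt_one h0 h1).eventually (gt_mem_nhds hε)]
    with n hn
  rwa [Real.rpow_mul_natCast (by linarith)]

theorem exists_dimension_hasThreeTermAP (hq : Odd q) {β : ℝ} (hβ : 2 / 3 < β) (hβ1 : β < 1) :
    ∃ α : ℝ, 0 < α ∧ α < 1 ∧ ∀ (E : Set (FqInf q)) (μ : Measure (FqInf q)),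
      CompactCarrier E μ → PartialBallCondition E μ α → FourierDecay μ β → HasThreeTermAP E := by
  classical
  obtain ⟨c, hc0, hc1, hcap⟩ := exists_powerSaving (q := q) hq
  have hq1 : (1 : ℝ) < q := by exact_mod_cast (Fact.out : q.Prime).one_lt
  have hq0 : (0 : ℝ) < q := by linarith
  set κ : ℝ := 3 * β / 2 - 1 with hκ
  have hκ0 : 0 < κ := by linarith
  have hκ1 : κ < 1 / 2 := by linarith
  -- The auxiliary dimension is d ≈ γn. With α = 1 - cγ/2 the heavy cells have density at least
  -- about q^(-cγn/2), well above the progression-free density q^(-cγn) in dimension `d`. The lower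
  -- bound loses q^(-(γ + cγ/2)n), and γ + cγ/2 ≤ 3γ/2 = κ/2 < κ.
  set γ : ℝ := κ / 3 with hγ
  have hcγ : 0 < c * γ := mul_pos hc0 (by linarith)
  have hcγ1 : c * γ ≤ γ := mul_le_of_le_one_left (by linarith) hc1
  refine ⟨1 - c * γ / 2, by linarith, by linarith, ?_⟩
  rintro E μ hE ⟨C₁, hC₁, E', hE'meas, hE'E, hE'pos, hball⟩ hdec
  have := hE.isProbabilityMeasure
  by_contra hAP
  obtain ⟨K, hK, hup⟩ := exists_approxAPs_le hq hE hAP hβ hdec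
  set m : ℝ := μ.real E' with hm
  have hm0 : 0 < m := ENNReal.toReal_pos hE'pos.ne' (measure_ne_top _ _)
  set c₂ : ℝ := m / (2 * C₁) with hc₂
  have hc₂0 : 0 < c₂ := by positivity
  -- The three conditions give, in turn, the density needed for supersaturation (12 = 4 · 3), the
  -- inequality 4 q^d ≤ q^n, and the final contradiction. The spare factors q absorb the rounding in
  -- `d`.
  obtain ⟨n, hn1, hn2, hn3⟩ := ((eventually_rpow_mul_lt hq1 (a := -(c * γ / 2)) (ε := c₂ / 12)
    (by linarith) (by positivity)).and ((eventually_rpow_mul_lt hq1 (a := γ - 1) (ε := 1 / (4 * q))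
    (by linarith) (by positivity)).and (eventually_rpow_mul_lt hq1 (a := -(κ / 2))
    (ε := c₂ * m ^ 3 / (16 * q * K)) (by linarith) (by positivity)))).exists
  set d : ℕ := ⌈γ * n⌉₊ with hd
  have hd1 : γ * n ≤ d := Nat.le_ceil _
  have hd2 : (d : ℝ) ≤ γ * n + 1 :=
    (Nat.ceil_lt_add_one (mul_nonneg (by linarith) (Nat.cast_nonneg n))).le
  have hpn : ∀ k : ℕ, (q : ℝ) ^ k = (q : ℝ) ^ (k : ℝ) := fun k => (Real.rpow_natCast _ _).symm
  have hmono : ∀ {a b : ℝ}, a ≤ b → (q : ℝ) ^ a ≤ (q : ℝ) ^ b := fun h =>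
    Real.rpow_le_rpow_of_exponent_le hq1.le h
  obtain ⟨A, hAcard, hAw⟩ := exists_heavy_cells hE'meas fun i => hball.measureReal_cell_le hC₁ n i
  have hcardV : (Fintype.card (Fin n → ZMod q) : ℝ) = (q : ℝ) ^ n := by simp [ZMod.card]
  have hcardK : (Fintype.card (ZMod q) : ℝ) = q := by rw [ZMod.card]
  have hNpos : (0 : ℝ) < (q : ℝ) ^ n := by positivity
  have hA : c₂ * ((q : ℝ) ^ n * (q : ℝ) ^ (-(c * γ / 2) * n)) ≤ A.card := by
    have e : (q : ℝ) ^ n * (q : ℝ) ^ (-(c * γ / 2) * n) * (q : ℝ) ^ (-((1 - c * γ / 2) * n)) = 1 := by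
      rw [hpn, ← Real.rpow_add hq0, ← Real.rpow_add hq0, show (n : ℝ) + -(c * γ / 2) * n +
        -((1 - c * γ / 2) * n) = 0 by ring, Real.rpow_zero]
    have hpos : 0 < C₁ * (q : ℝ) ^ (-((1 - c * γ / 2) * n)) := by positivity
    refine le_of_mul_le_mul_right (le_trans (le_of_eq ?_) (show m / 2 ≤ _ by linarith)) hpos
    calc _ = c₂ * C₁ * ((q : ℝ) ^ n * (q : ℝ) ^ (-(c * γ / 2) * n) *
          (q : ℝ) ^ (-((1 - c * γ / 2) * n))) := by ring
      _ = m / 2 := by rw [e, hc₂]; field_simp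
  have hcount := le_card_apPairs_ne_zero (hcap d) A (by
    rw [hcardV, hcardK]
    have h1 : (q : ℝ) ^ ((1 - c) * d) ≤
        (q : ℝ) ^ d * ((q : ℝ) ^ (-(c * γ / 2) * n) * (q : ℝ) ^ (-(c * γ / 2) * n)) := by
      rw [hpn, ← Real.rpow_add hq0, ← Real.rpow_add hq0]
      apply hmono
      nlinarith
    have h2 : 12 * (q : ℝ) ^ (-(c * γ / 2) * n) ≤ c₂ := by linarith
    have hx : 0 < (q : ℝ) ^ (-(c * γ / 2) * n) := by positivity
    have hQ : 0 < (q : ℝ) ^ d := by positivity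
    calc 4 * (3 * (q : ℝ) ^ ((1 - c) * d)) * (q : ℝ) ^ n
        ≤ 4 * (3 * ((q : ℝ) ^ d * ((q : ℝ) ^ (-(c * γ / 2) * n) * (q : ℝ) ^ (-(c * γ / 2) * n)))) *
          (q : ℝ) ^ n := by gcongr
      _ = (12 * (q : ℝ) ^ (-(c * γ / 2) * n)) * ((q : ℝ) ^ n * (q : ℝ) ^ (-(c * γ / 2) * n)) *
          (q : ℝ) ^ d := by ring
      _ ≤ c₂ * ((q : ℝ) ^ n * (q : ℝ) ^ (-(c * γ / 2) * n)) * (q : ℝ) ^ d := by gcongr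
      _ ≤ A.card * (q : ℝ) ^ d := by gcongr) (by
    rw [hcardV, hcardK]
    have h1 : (q : ℝ) ^ d ≤ q * ((q : ℝ) ^ n * (q : ℝ) ^ ((γ - 1) * n)) := by
      nth_rw 2 [← Real.rpow_one (q : ℝ)]
      rw [hpn d, hpn n, ← Real.rpow_add hq0, ← Real.rpow_add hq0]
      apply hmono
      nlinarith
    have h2 : q * (q : ℝ) ^ ((γ - 1) * n) ≤ 1 / 4 := by
      calc _ ≤ q * (1 / (4 * (q : ℝ))) := by gcongr
        _ = 1 / 4 := by field_simp
    nlinarith)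
  rw [hcardV, hcardK] at hcount
  have hlow := sum_mul_le_approxAPs μ A (w := m / (2 * (q : ℝ) ^ n)) (by positivity) hAw
  have hupn := hup n
  set T : ℝ := (((apPairs A).filter fun p => p.2 ≠ 0).card : ℝ) with hT
  set R : ℝ := (μ.prod (μ.prod μ)).real (approxAPs q n n) with hR
  have hθ : ((q : ℝ) ^ (1 - 3 * β / 2)) ^ n = (q : ℝ) ^ (-κ * n) := by
    rw [← Real.rpow_mul_natCast hq0.le, hκ]; congr 1; ring
  rw [hθ] at hupn
  have hx : 0 < (q : ℝ) ^ (-(c * γ / 2) * n) := by positivity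
  have hchain : c₂ * m ^ 3 * (q : ℝ) ^ (-(c * γ / 2) * n) ≤
      16 * K * ((q : ℝ) ^ d * (q : ℝ) ^ (-κ * n)) := by
    have s1 : (q : ℝ) ^ n * (c₂ * ((q : ℝ) ^ n * (q : ℝ) ^ (-(c * γ / 2) * n))) ≤
        2 * (q : ℝ) ^ d * T := (mul_le_mul_of_nonneg_left hA hNpos.le).trans hcount
    have s2 : (q : ℝ) ^ n * (T * (m / (2 * (q : ℝ) ^ n)) ^ 3) ≤ K * (q : ℝ) ^ (-κ * n) :=
      (mul_le_mul_of_nonneg_left hlow hNpos.le).trans hupn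
    have s3 : (q : ℝ) ^ n * (T * (m / (2 * (q : ℝ) ^ n)) ^ 3) =
        T * m ^ 3 / (8 * ((q : ℝ) ^ n) ^ 2) := by field_simp; ring
    rw [s3, div_le_iff₀ (by positivity)] at s2
    have hN2 : 0 < ((q : ℝ) ^ n) ^ 2 := by positivity
    have hQ : 0 < (q : ℝ) ^ d := by positivity
    refine le_of_mul_le_mul_left ?_ hN2
    calc _ = (q : ℝ) ^ n * (c₂ * ((q : ℝ) ^ n * (q : ℝ) ^ (-(c * γ / 2) * n))) * m ^ 3 := by ring
      _ ≤ 2 * (q : ℝ) ^ d * T * m ^ 3 := by gcongr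
      _ = 2 * (q : ℝ) ^ d * (T * m ^ 3) := by ring
      _ ≤ 2 * (q : ℝ) ^ d * (K * (q : ℝ) ^ (-κ * n) * (8 * ((q : ℝ) ^ n) ^ 2)) := by gcongr
      _ = _ := by ring
  have hexp : (q : ℝ) ^ d * (q : ℝ) ^ (-κ * n) ≤
      q * (q : ℝ) ^ (-(κ / 2) * n) * (q : ℝ) ^ (-(c * γ / 2) * n) := by
    nth_rw 3 [← Real.rpow_one (q : ℝ)]
    rw [hpn, ← Real.rpow_add hq0, ← Real.rpow_add hq0, ← Real.rpow_add hq0]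
    apply hmono
    have hn0 : (0 : ℝ) ≤ n := Nat.cast_nonneg n
    have h1 : c * γ * n ≤ γ * n := mul_le_mul_of_nonneg_right hcγ1 hn0
    have h2 : κ * n = 3 * (γ * n) := by rw [hγ]; ring
    linarith
  have hfin : c₂ * m ^ 3 ≤ 16 * K * (q * (q : ℝ) ^ (-(κ / 2) * n)) := by
    refine le_of_mul_le_mul_right (hchain.trans ?_) hx
    rw [mul_assoc (16 * K)]
    gcongr
  rw [lt_div_iff₀ (by positivity)] at hn3
  linarith

end Main

end FqInf

theorem theorem1 (q : ℕ) [Fact q.Prime] (hq : Odd q) :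
    (∀ β : ℝ, 2 / 3 < β → β < 1 →
      (∃ α : ℝ, 0 < α ∧ α < 1 ∧
        ∀ (E : Set (FqInf q)) (μ : MeasureTheory.Measure (FqInf q)),
          FqInf.CompactCarrier E μ → FqInf.PartialBallCondition E μ α →
          FqInf.FourierDecay μ β → FqInf.HasThreeTermAP E) ∧
      (∀ (E : Set (FqInf q)) (μ : MeasureTheory.Measure (FqInf q)),
          FqInf.CompactCarrier E μ → FqInf.FourierDecay μ β →
          ∀ α : ℝ, 0 ≤ α → α < β → FqInf.PartialBallCondition E μ α)) ∧
    (∃ β₀ : ℝ, β₀ < 1 ∧ ∀ β : ℝ, β₀ < β → β < 1 →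
      ∀ (E : Set (FqInf q)) (μ : MeasureTheory.Measure (FqInf q)),
        FqInf.CompactCarrier E μ → FqInf.FourierDecay μ β →
        FqInf.HasThreeTermAP E) := by
  refine ⟨fun β hβ hβ1 => ⟨FqInf.exists_dimension_hasThreeTermAP hq hβ hβ1,
    fun E μ hE hdec α hα hαβ =>
      FqInf.partialBallCondition_of_fourierDecay hE hβ1 hdec hα hαβ⟩, ?_⟩
  -- The α obtained for a given β might exceed that β. Fixing the exponent 3/4 gives one α, and
  -- every β above both numbers supplies the decay at 3/4 and the ball condition at α.
  obtain ⟨α, hα0, hα1, hAP⟩ :=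
    FqInf.exists_dimension_hasThreeTermAP hq (β := 3 / 4) (by norm_num) (by norm_num)
  refine ⟨max (3 / 4) α, max_lt (by norm_num) hα1, fun β hβ hβ1 E μ hE hdec => ?_⟩
  have h1 : 3 / 4 < β := (le_max_left _ _).trans_lt hβ
  have h2 : α < β := (le_max_right _ _).trans_lt hβ
  exact hAP E μ hE (FqInf.partialBallCondition_of_fourierDecay hE hβ1 hdec hα0.le h2)
    (hdec.mono h1.le)
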